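/- Let $M$ be a smooth manifold (finite-dimensional, real, Hausdorff, second countable, without boundary), let $\mathcal A = C^\infty(M)$ be the algebra of smooth complex-valued functions, and let $E \to M$ be a smooth complex vector bundle of (constant) finite rank, with $\mathcal A$-module of smooth sections $\Gamma^\infty(E)$. Differential operators are $\mathbb C$-linear, with smooth coefficients and of finite order. A bidifferential operator is a $\mathbb C$-bilinear map that is a differential operator of bounded order in each of its two arguments, the bound being uniform in the other argument. A *star product* $\star$ on $M$ is an associative $\mathbb C[[\lambda]]$-bilinear multiplication on $\mathcal A[[\lambda]]$ of the form $$f \star g = \sum_{r=0}^\infty \lambda^r C_r(f,g) \qquad (f, g \in \mathcal A)$$ with bidifferential operators $C_r : \mathcal A \times \mathcal A \to \mathcal A$ and $C_0(f,g) = fg$. (The normalization $1 \star f = f = f \star 1$ is allowed but not required.) A *deformation quantization* $\bullet$ of $E$ with respect to $\star$ is a unital right $(\mathcal A[[\lambda]], \star)$-module structure on $\Gamma^\infty(E)[[\lambda]]$, that is, a $\mathbb C[[\lambda]]$-bilinear map with $\phi \bullet (f \star g) = (\phi \bullet f) \bullet g$ for all $\phi, f, g$ and $\phi \bullet e = \phi$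 for all $\phi$ whenever $e$ is a two-sided unit element for $\star$, of the form $$\phi \bullet f = \sum_{r=0}^\infty \lambda^r R_r(\phi, f) \qquad (\phi \in \Gamma^\infty(E),\ f \in \mathcal A)$$ with bidifferential operators $R_r : \Gamma^\infty(E) \times \mathcal A \to \Gamma^\infty(E)$ and $R_0(\phi, f) = \phi f$ the pointwise product. Two deformation quantizations $\bullet$ and $\tilde\bullet$ of $E$ with respect to $\star$ are *equivalent* if there is a formal series $T = \mathrm{id} + \sum_{r \ge 1} \lambda^r T_r$ of differential operators $T_r : \Gamma^\infty(E) \to \Gamma^\infty(E)$, extended $\mathbb C[[\lambda]]$-linearly to $\Gamma^\infty(E)[[\lambda]]$, such that $T(\phi \bullet f) = T(\phi) \mathbin{\tilde\bullet} f$ for all $\phi \in \Gamma^\infty(E)[[\lambda]]$ and $f \in \mathcal A[[\lambda]]$. **Theorem.** For every star product $\star$ on $M$ and every smooth complex vector bundle $E \to M$ there exists a deformation quantization $\bullet$ of $E$ with respect to $\star$, and any two deformation quantizations of $E$ with respect to $\star$ are equivalent. -/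

import Mathlib

open scoped Manifold ContDiff

/-! ### Differential operators over a commutative algebra -/

namespace DefQuant

section DiffOp

variable {A : Type*} [CommRing A] [Algebra ℂ A]
  {V : Type*} [AddCommGroup V] [Module ℂ V] [Module A V] [IsScalarTower ℂ A V]
  {W : Type*} [AddCommGroup W] [Module ℂ W] [Module A W] [IsScalarTower ℂ A W]

/-- The commutator `[D, f] : v ↦ D (f v) - f (D v)` of a `ℂ`-linear map `D` with the
multiplication by `f`. -/
def comm (D : V →ₗ[ℂ] W) (f : A) : V →ₗ[ℂ] W :=
  D ∘ₗ Algebra.lsmul ℂ ℂ V f - Algebra.lsmul ℂ ℂ W f ∘ₗ D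

variable (A) in
/-- `IsDiffOpOfOrder A k D`: the `ℂ`-linear map `D` between `A`-modules is a differential operator
of order at most `k`. Order at most `0` means `A`-linear, and `D` has order at most `k + 1` if all
commutators `[D, f]`, `f ∈ A`, have order at most `k`. For `A = C^∞(M, ℂ)` and modules of smooth
sections of vector bundles over `M` these are the usual linear differential operators with smooth
coefficients. -/
def IsDiffOpOfOrder : ℕ → (V →ₗ[ℂ] W) → Prop
  | 0, D => ∀ f : A, comm D f = 0
  | k + 1, D => ∀ f : A, IsDiffOpOfOrder k (comm D f)

variable (A) in
/-- Differential operators (of some finite order). -/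
def IsDiffOp (D : V →ₗ[ℂ] W) : Prop :=
  ∃ k, IsDiffOpOfOrder A k D

variable (A) in
/-- Bidifferential operators: `ℂ`-bilinear maps that are differential operators, of uniformly
bounded order, in each of the two arguments. -/
def IsBidiffOp {U : Type*} [AddCommGroup U] [Module ℂ U] [Module A U] [IsScalarTower ℂ A U]
    (B : V →ₗ[ℂ] W →ₗ[ℂ] U) : Prop :=
  ∃ k l, (∀ w, IsDiffOpOfOrder A k (B.flip w)) ∧ ∀ v, IsDiffOpOfOrder A l (B v)

end DiffOp

/-! ### Formal power series and formal deformations -/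

/-- Formal power series `V[[λ]]` with coefficients in a vector space `V`: the sequence `v`
stands for `∑ r, λ ^ r v r`. -/
abbrev FormalSeries (V : Type*) := ℕ → V

/-- The `ℂ[[λ]]`-linear map `V[[λ]] → W[[λ]]` given by `∑ r, λ ^ r T r`, that is,
`(∑ λ ^ r T r) (∑ λ ^ s v s) = ∑ λ ^ (r + s) T r (v s)`. -/
def formalLin {V W : Type*} [AddCommGroup V] [Module ℂ V] [AddCommGroup W] [Module ℂ W]
    (T : ℕ → V →ₗ[ℂ] W) (v : FormalSeries V) : FormalSeries W :=
  fun n => ∑ p ∈ Finset.HasAntidiagonal.antidiagonal n, T p.1 (v p.2)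

/-- The `ℂ[[λ]]`-bilinear map `V[[λ]] × W[[λ]] → U[[λ]]` given by `∑ r, λ ^ r B r`, that is,
`(∑ λ ^ s v s, ∑ λ ^ t w t) ↦ ∑ λ ^ (r + s + t) B r (v s, w t)`. -/
def formalBilin {V W U : Type*} [AddCommGroup V] [Module ℂ V] [AddCommGroup W] [Module ℂ W]
    [AddCommGroup U] [Module ℂ U]
    (B : ℕ → V →ₗ[ℂ] W →ₗ[ℂ] U) (v : FormalSeries V) (w : FormalSeries W) : FormalSeries U :=
  fun n => ∑ p ∈ Finset.HasAntidiagonal.antidiagonal n, ∑ q ∈ Finset.HasAntidiagonal.antidiagonal p.2, B p.1 (v q.1) (w q.2)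

/-- A star product on the commutative algebra `A` (to be applied to `A = C^∞(M, ℂ)`): an
associative `ℂ[[λ]]`-bilinear multiplication `f ⋆ g = ∑ r, λ ^ r C r f g` on `A[[λ]]` with
bidifferential operators `C r`, where `C 0` is the given commutative product. The normalization
`1 ⋆ f = f = f ⋆ 1` is allowed but not required. -/
structure StarProduct (A : Type*) [CommRing A] [Algebra ℂ A] where
  /-- The coefficients of the star product. -/
  C : ℕ → A →ₗ[ℂ] A →ₗ[ℂ] A
  C_zero : ∀ f g, C 0 f g = f * g
  isBidiffOp : ∀ r, IsBidiffOp A (C r)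
  assoc : ∀ f g h : FormalSeries A,
    formalBilin C (formalBilin C f g) h = formalBilin C f (formalBilin C g h)

section

variable {A : Type*} [CommRing A] [Algebra ℂ A]

/-- The multiplication `f ⋆ g` on `A[[λ]]`. -/
def StarProduct.mul (S : StarProduct A) (f g : FormalSeries A) : FormalSeries A :=
  formalBilin S.C f g

/-- `e` is a two-sided unit element of `(A[[λ]], ⋆)`. -/
def StarProduct.IsUnitElement (S : StarProduct A) (e : FormalSeries A) : Prop :=
  ∀ f, S.mul e f = f ∧ S.mul f e = f

/-- A deformation quantization `•` of the `A`-module `Γ` (to be applied to the smooth sections of a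
vector bundle) with respect to `⋆`: a (unital) right module structure on `Γ[[λ]]` over
`(A[[λ]], ⋆)` of the form `φ • f = ∑ r, λ ^ r R r φ f` with bidifferential operators `R r`, where
`R 0` is the given module structure. -/
structure DeformationQuantization (S : StarProduct A) (Γ : Type*) [AddCommGroup Γ] [Module ℂ Γ]
    [Module A Γ] [IsScalarTower ℂ A Γ] where
  /-- The coefficients of the right module structure. -/
  R : ℕ → Γ →ₗ[ℂ] A →ₗ[ℂ] Γ
  R_zero : ∀ φ f, R 0 φ f = f • φ
  isBidiffOp : ∀ r, IsBidiffOp A (R r)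
  act_mul : ∀ (φ : FormalSeries Γ) (f g : FormalSeries A),
    formalBilin R φ (S.mul f g) = formalBilin R (formalBilin R φ f) g
  act_unit : ∀ e : FormalSeries A, S.IsUnitElement e → ∀ φ : FormalSeries Γ,
    formalBilin R φ e = φ

variable {S : StarProduct A} {Γ : Type*} [AddCommGroup Γ] [Module ℂ Γ] [Module A Γ]
  [IsScalarTower ℂ A Γ]

/-- The right multiplication `φ • f` on `Γ[[λ]]`. -/
def DeformationQuantization.act (b : DeformationQuantization S Γ) (φ : FormalSeries Γ)
    (f : FormalSeries A) : FormalSeries Γ :=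
  formalBilin b.R φ f

/-- Two deformation quantizations `•` and `•'` are equivalent if there is a formal series of
differential operators `T = id + ∑ r ≥ 1, λ ^ r T r` with `T (φ • f) = T φ •' f`. -/
def DeformationQuantization.Equivalent (b b' : DeformationQuantization S Γ) : Prop :=
  ∃ T : ℕ → Γ →ₗ[ℂ] Γ, T 0 = LinearMap.id ∧ (∀ r, IsDiffOp A (T r)) ∧
    ∀ (φ : FormalSeries Γ) (f : FormalSeries A),
      formalLin T (b.act φ f) = b'.act (formalLin T φ) f

end

/-! ### Complex-valued smooth functions and sections of complex vector bundles -/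

section Manifold

variable {d : ℕ} {M : Type*} [TopologicalSpace M] [ChartedSpace (EuclideanSpace ℝ (Fin d)) M]

/-- `C^∞(M, ℂ)`, smooth complex-valued functions on a real manifold. -/
abbrev SmoothFun (d : ℕ) (M : Type*) [TopologicalSpace M]
    [ChartedSpace (EuclideanSpace ℝ (Fin d)) M] := C^∞⟮𝓡 d, M; 𝓘(ℝ, ℂ), ℂ⟯

instance instContMDiffRingComplex : ContMDiffRing 𝓘(ℝ, ℂ) ∞ ℂ :=
  { instNormedSpaceLieAddGroup with
    contMDiff_mul := by
      rw [contMDiff_iff]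
      refine ⟨continuous_mul, fun x y => ?_⟩
      simp only [mfld_simps, chartAt_self_eq]
      rw [contDiffOn_univ]
      exact contDiff_mul }

noncomputable instance instAlgebraSmoothFun : Algebra ℂ (SmoothFun d M) where
  smul c f := ⟨fun x => c * f x, contMDiff_const.mul f.contMDiff⟩
  algebraMap :=
    { toFun := fun c => ⟨fun _ => c, contMDiff_const⟩
      map_one' := rfl
      map_mul' := fun _ _ => rfl
      map_zero' := rfl
      map_add' := fun _ _ => rfl }
  commutes' _ _ := mul_comm _ _
  smul_def' _ _ := rfl

theorem SmoothFun.smul_apply (c : ℂ) (f : SmoothFun d M) (x : M) : (c • f) x = c * f x := rfl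

variable {F : Type*} [NormedAddCommGroup F] [NormedSpace ℂ F]
  {V : M → Type*} [TopologicalSpace (Bundle.TotalSpace F V)]
  [∀ x, TopologicalSpace (V x)] [∀ x, AddCommGroup (V x)] [∀ x, Module ℂ (V x)]
  [FiberBundle F V]

/-- A complex vector bundle is a real vector bundle. -/
instance (priority := 50) instVectorBundleReal {B : Type*} [TopologicalSpace B] {F : Type*}
    [NormedAddCommGroup F] [NormedSpace ℂ F]
    {V : B → Type*} [TopologicalSpace (Bundle.TotalSpace F V)]
    [∀ x, TopologicalSpace (V x)] [∀ x, AddCommGroup (V x)] [∀ x, Module ℂ (V x)]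
    [FiberBundle F V] [VectorBundle ℂ F V] : VectorBundle ℝ F V := by
  have hlin : ∀ (e : Bundle.Trivialization F (Bundle.TotalSpace.proj : Bundle.TotalSpace F V → B))
      [MemTrivializationAtlas e], e.IsLinear ℝ := fun e _ =>
    ⟨fun b hb => ⟨fun x y => (e.linear ℂ hb).map_add x y, fun c x => by
      have := (e.linear ℂ hb).map_smul (c : ℂ) x
      simpa only [Complex.coe_smul] using this⟩⟩
  refine ⟨hlin, fun e e' _ _ => ?_⟩
  have h := (ContinuousLinearMap.restrictScalarsIsometry ℂ F F ℝ ℝ).continuous.comp_continuousOn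
    (VectorBundle.continuousOn_coordChange' (R := ℂ) e e')
  refine h.congr fun b hb => ?_
  ext v
  have := hlin e
  have := hlin e'
  change e.coordChangeL ℝ e' b v = e.coordChangeL ℂ e' b v
  rw [e.coordChangeL_apply e' hb, e.coordChangeL_apply e' hb]

variable [VectorBundle ℂ F V]

/-- `Γ^∞(E)`, smooth sections of a complex vector bundle over a real manifold. -/
abbrev SmoothSec (d : ℕ) {M : Type*} [TopologicalSpace M]
    [ChartedSpace (EuclideanSpace ℝ (Fin d)) M]
    (F : Type*) [NormedAddCommGroup F] [NormedSpace ℂ F]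
    (V : M → Type*) [TopologicalSpace (Bundle.TotalSpace F V)]
    [∀ x, TopologicalSpace (V x)] [FiberBundle F V] := Cₛ^∞⟮𝓡 d; F, V⟯

theorem contMDiff_smul_section (f : SmoothFun d M) (s : SmoothSec d F V) :
    ContMDiff (𝓡 d) ((𝓡 d).prod 𝓘(ℝ, F)) ∞ fun x => Bundle.TotalSpace.mk' F x (f x • s x) := by
  intro x₀
  have hs := s.contMDiff x₀
  rw [Bundle.contMDiffAt_section] at hs ⊢
  have hsm : ContDiff ℝ ∞ fun p : ℂ × F => p.1 • p.2 := contDiff_fst.smul contDiff_snd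
  have h := hsm.contMDiff.contMDiffAt.comp x₀ ((f.contMDiff x₀).prodMk_space hs)
  refine h.congr_of_eventuallyEq ?_
  filter_upwards [(trivializationAt F V x₀).open_baseSet.mem_nhds
    (FiberBundle.mem_baseSet_trivializationAt' x₀)] with x hx
  exact ((trivializationAt F V x₀).linear ℂ hx).map_smul (f x) (s x)

/-- Pointwise multiplication of sections by smooth functions. -/
noncomputable instance instSMulSmoothFun : SMul (SmoothFun d M) (SmoothSec d F V) :=
  ⟨fun f s => ⟨fun x => f x • s x, contMDiff_smul_section f s⟩⟩

theorem SmoothSec.smul_apply (f : SmoothFun d M) (s : SmoothSec d F V) (x : M) :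
    (f • s) x = f x • s x := rfl

noncomputable instance instModuleSmoothFun : Module (SmoothFun d M) (SmoothSec d F V) where
  one_smul s := ContMDiffSection.ext fun x => one_smul ℂ (s x)
  mul_smul f g s := ContMDiffSection.ext fun x => mul_smul (f x) (g x) (s x)
  smul_zero f := ContMDiffSection.ext fun x => smul_zero (f x)
  smul_add f s t := ContMDiffSection.ext fun x => smul_add (f x) (s x) (t x)
  add_smul f g s := ContMDiffSection.ext fun x => add_smul (f x) (g x) (s x)
  zero_smul s := ContMDiffSection.ext fun x => zero_smul ℂ (s x)

noncomputable instance instModuleComplex : Module ℂ (SmoothSec d F V) :=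
  Module.compHom _ (algebraMap ℂ (SmoothFun d M))

theorem SmoothSec.complex_smul_apply (c : ℂ) (s : SmoothSec d F V) (x : M) :
    (c • s) x = c • s x := rfl

instance instIsScalarTower : IsScalarTower ℂ (SmoothFun d M) (SmoothSec d F V) where
  smul_assoc c f s := ContMDiffSection.ext fun x => mul_smul c (f x) (s x)

end Manifold

end DefQuant

/-! Both claims are proved one power of `λ` at a time. If a candidate action, or a candidate
intertwiner, satisfies its equation below degree `n`, then its defect in degree `n` is a Hochschild
cocycle of `A` (degree 2 for the action, degree 1 for the intertwiner) with values in the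
differential operators on `Γ`. The new coefficient corrects the defect exactly when its coboundary
is that cocycle.

These cocycles are coboundaries because `Γ` behaves like a projective module. Given sections `s i`
and `A`-linear forms `ξ i` with `φ = ∑ ξ i φ • s i`, substituting the frame into the first two slots
gives a contracting homotopy: `x(φ, f) = ∑ E(s i, ξ i φ, f)` in degree 2 and `x(φ) = -∑ c(s i, ξ i
φ)` in degree 1 (`exists_bidiff_primitive`, `exists_diff_primitive`). On a manifold the frame comes
from a partition of unity subordinate to trivializations (`exists_locallyFiniteFrame`). It may be
infinite, and the sums make sense because differential operators are local. They are again
differential operators because the cocycle has one order bound for all values of its other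
arguments.

Unitality comes for free: `φ ↦ φ • e` is an idempotent deformation of the identity, hence the
identity. -/

namespace DefQuant

/-! ### Calculus of algebraic differential operators and of families with uniform order bounds. -/

section DiffFun

variable {A : Type*} [CommRing A] [Algebra ℂ A]
  {V : Type*} [AddCommGroup V] [Module ℂ V] [Module A V] [IsScalarTower ℂ A V]
  {W : Type*} [AddCommGroup W] [Module ℂ W] [Module A W] [IsScalarTower ℂ A W]
  {U : Type*} [AddCommGroup U] [Module ℂ U] [Module A U] [IsScalarTower ℂ A U]

@[simp] theorem comm_apply (D : V →ₗ[ℂ] W) (f : A) (v : V) :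
    comm D f v = D (f • v) - f • D v := rfl

theorem comm_add (D D' : V →ₗ[ℂ] W) (f : A) : comm (D + D') f = comm D f + comm D' f := by
  ext v
  simp only [comm_apply, LinearMap.add_apply, smul_add]
  abel

theorem comm_zero (f : A) : comm (0 : V →ₗ[ℂ] W) f = 0 := by
  ext v
  simp

theorem comm_comp (D : W →ₗ[ℂ] U) (D' : V →ₗ[ℂ] W) (f : A) :
    comm (D ∘ₗ D') f = D ∘ₗ comm D' f + comm D f ∘ₗ D' := by
  ext v
  simp

theorem IsDiffOpOfOrder.zero : ∀ k, IsDiffOpOfOrder A k (0 : V →ₗ[ℂ] W)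
  | 0 => fun f => comm_zero f
  | k + 1 => fun f => by
    rw [comm_zero]
    exact IsDiffOpOfOrder.zero k

theorem IsDiffOpOfOrder.succ : ∀ {k} {D : V →ₗ[ℂ] W}, IsDiffOpOfOrder A k D →
    IsDiffOpOfOrder A (k + 1) D
  | 0, D, h => fun f => by
    rw [h f]
    exact IsDiffOpOfOrder.zero 0
  | _ + 1, _, h => fun f => IsDiffOpOfOrder.succ (h f)

theorem IsDiffOpOfOrder.mono {k l : ℕ} {D : V →ₗ[ℂ] W} (h : IsDiffOpOfOrder A k D) (hkl : k ≤ l) :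
    IsDiffOpOfOrder A l D := by
  induction hkl with
  | refl => exact h
  | step _ ih => exact ih.succ

theorem IsDiffOpOfOrder.add : ∀ {k} {D D' : V →ₗ[ℂ] W}, IsDiffOpOfOrder A k D →
    IsDiffOpOfOrder A k D' → IsDiffOpOfOrder A k (D + D')
  | 0, D, D', h, h' => fun f => by
    rw [comm_add, h f, h' f, add_zero]
  | _ + 1, D, D', h, h' => fun f => by
    rw [comm_add]
    exact (h f).add (h' f)

theorem IsDiffOpOfOrder.comp_linear {D : W →ₗ[ℂ] U} (hD : IsDiffOpOfOrder A 0 D) :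
    ∀ {k} {D' : V →ₗ[ℂ] W}, IsDiffOpOfOrder A k D' → IsDiffOpOfOrder A k (D ∘ₗ D')
  | 0, D', h => fun f => by
    rw [comm_comp, h f, hD f, LinearMap.comp_zero, LinearMap.zero_comp, add_zero]
  | _ + 1, D', h => fun f => by
    rw [comm_comp, hD f, LinearMap.zero_comp, add_zero]
    exact hD.comp_linear (h f)

/-- Double induction on the orders: by the Leibniz rule `comm_comp`, each term of the commutator
lowers the order of exactly one factor. -/
theorem IsDiffOpOfOrder.comp {k l : ℕ} {D : W →ₗ[ℂ] U} {D' : V →ₗ[ℂ] W}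
    (hD : IsDiffOpOfOrder A k D) (hD' : IsDiffOpOfOrder A l D') :
    IsDiffOpOfOrder A (k + l) (D ∘ₗ D') := by
  induction k generalizing l D D' with
  | zero => simpa using hD.comp_linear hD'
  | succ k ihk =>
    induction l generalizing D' with
    | zero =>
      intro f
      rw [comm_comp, hD' f, LinearMap.comp_zero, zero_add]
      exact ihk (hD f) hD'
    | succ l ihl =>
      intro f
      rw [comm_comp]
      refine (ihl (hD' f)).add ?_
      exact (ihk (hD f) hD').mono (by omega)

variable (A) in
/-- The function `D` is a `ℂ`-linear differential operator of order at most `k`. -/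
def IsDiffFun (k : ℕ) (D : V → W) : Prop :=
  ∃ D' : V →ₗ[ℂ] W, IsDiffOpOfOrder A k D' ∧ ∀ v, D' v = D v

theorem IsDiffOpOfOrder.isDiffFun {k : ℕ} {D : V →ₗ[ℂ] W} (h : IsDiffOpOfOrder A k D) :
    IsDiffFun A k D := ⟨D, h, fun _ => rfl⟩

namespace IsDiffFun

variable {k l : ℕ} {D D' : V → W}

theorem congr (h : IsDiffFun A k D) (hD : ∀ v, D' v = D v) : IsDiffFun A k D' := by
  obtain rfl : D' = D := funext hD
  exact h

theorem isDiffOpOfOrder {D : V →ₗ[ℂ] W} (h : IsDiffFun A k D) : IsDiffOpOfOrder A k D := by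
  obtain ⟨D', h, hD⟩ := h
  obtain rfl : D' = D := LinearMap.ext hD
  exact h

theorem map_add (h : IsDiffFun A k D) (v w : V) : D (v + w) = D v + D w := by
  obtain ⟨D', -, hD⟩ := h
  simp [← hD]

theorem map_smul (h : IsDiffFun A k D) (c : ℂ) (v : V) : D (c • v) = c • D v := by
  obtain ⟨D', -, hD⟩ := h
  simp [← hD]

theorem mono (h : IsDiffFun A k D) (hkl : k ≤ l) : IsDiffFun A l D := by
  obtain ⟨D', h, hD⟩ := h
  exact ⟨D', h.mono hkl, hD⟩

theorem zero : IsDiffFun A k (fun _ : V => (0 : W)) :=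
  ⟨0, .zero k, fun _ => rfl⟩

theorem add (h : IsDiffFun A k D) (h' : IsDiffFun A k D') :
    IsDiffFun A k (fun v => D v + D' v) := by
  obtain ⟨E, h, hE⟩ := h
  obtain ⟨E', h', hE'⟩ := h'
  exact ⟨E + E', h.add h', fun v => by simp [hE, hE']⟩

theorem comp {D : W → U} {D' : V → W} (h : IsDiffFun A k D) (h' : IsDiffFun A l D') :
    IsDiffFun A (k + l) (fun v => D (D' v)) := by
  obtain ⟨E, h, hE⟩ := h
  obtain ⟨E', h', hE'⟩ := h'
  exact ⟨E ∘ₗ E', h.comp h', fun v => by simp [hE, hE']⟩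

theorem linear (D : V →ₗ[A] W) : IsDiffFun A 0 D :=
  ⟨D.restrictScalars ℂ, fun f => by ext v; simp, fun _ => rfl⟩

theorem id : IsDiffFun A 0 (fun v : V => v) := linear LinearMap.id

theorem neg (h : IsDiffFun A k D) : IsDiffFun A k (fun v => - D v) := by
  simpa using (linear (A := A) (-LinearMap.id : W →ₗ[A] W)).comp h

theorem sub (h : IsDiffFun A k D) (h' : IsDiffFun A k D') :
    IsDiffFun A k (fun v => D v - D' v) := by
  simpa only [sub_eq_add_neg] using h.add h'.neg

end IsDiffFun

/-- A family of functions depending on a parameter consists of differential operators of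
uniformly bounded order. -/
def IsDiffFamily (A : Type*) [CommRing A] [Algebra ℂ A]
    {V : Type*} [AddCommGroup V] [Module ℂ V] [Module A V] [IsScalarTower ℂ A V]
    {W : Type*} [AddCommGroup W] [Module ℂ W] [Module A W] [IsScalarTower ℂ A W]
    {X : Type*} (D : X → V → W) : Prop :=
  ∃ k, ∀ x, IsDiffFun A k (D x)

namespace IsDiffFamily

variable {X Y : Type*} {D D' : X → V → W}

theorem add (h : IsDiffFamily A D) (h' : IsDiffFamily A D') :
    IsDiffFamily A (fun x v => D x v + D' x v) := by
  obtain ⟨k, h⟩ := h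
  obtain ⟨k', h'⟩ := h'
  exact ⟨max k k', fun x => ((h x).mono (le_max_left _ _)).add ((h' x).mono (le_max_right _ _))⟩

theorem neg (h : IsDiffFamily A D) : IsDiffFamily A (fun x v => - D x v) := by
  obtain ⟨k, h⟩ := h
  exact ⟨k, fun x => (h x).neg⟩

theorem sub (h : IsDiffFamily A D) (h' : IsDiffFamily A D') :
    IsDiffFamily A (fun x v => D x v - D' x v) := by
  simpa only [sub_eq_add_neg] using h.add h'.neg

theorem zero : IsDiffFamily A (fun (_ : X) (_ : V) => (0 : W)) := ⟨0, fun _ => .zero⟩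

theorem sum {ι : Type*} (s : Finset ι) {D : ι → X → V → W}
    (h : ∀ i ∈ s, IsDiffFamily A (D i)) :
    IsDiffFamily A (fun x v => ∑ i ∈ s, D i x v) := by
  classical
  induction s using Finset.induction_on with
  | empty => simpa using zero
  | insert i s hi ih =>
    simp only [Finset.sum_insert hi]
    exact (h i (Finset.mem_insert_self _ _)).add (ih fun j hj => h j (Finset.mem_insert_of_mem hj))

theorem comp {D : Y → W → U} {D' : X → V → W} (h : IsDiffFamily A D) (h' : IsDiffFamily A D')
    (p : X → Y) : IsDiffFamily A (fun x v => D (p x) (D' x v)) := by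
  obtain ⟨k, h⟩ := h
  obtain ⟨k', h'⟩ := h'
  exact ⟨k + k', fun x => (h _).comp (h' x)⟩

theorem reparam (h : IsDiffFamily A D) (p : Y → X) : IsDiffFamily A (fun y => D (p y)) := by
  obtain ⟨k, h⟩ := h
  exact ⟨k, fun y => h (p y)⟩

theorem isDiffFun (h : IsDiffFamily A D) (x : X) : ∃ k, IsDiffFun A k (D x) :=
  h.imp fun _ h => h x

end IsDiffFamily

/-- Treating one argument as a mere parameter lets sums and compositions of bidifferential operators
be handled by `IsDiffFamily` without rebuilding bilinear maps. -/
theorem isBidiffOp_iff {B : V →ₗ[ℂ] W →ₗ[ℂ] U} :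
    IsBidiffOp A B ↔
      IsDiffFamily A (fun w v => B v w) ∧ IsDiffFamily A (fun v w => B v w) := by
  constructor
  · rintro ⟨k, l, hk, hl⟩
    exact ⟨⟨k, fun w => (hk w).isDiffFun⟩, ⟨l, fun v => (hl v).isDiffFun⟩⟩
  · rintro ⟨⟨k, hk⟩, ⟨l, hl⟩⟩
    exact ⟨k, l, fun w => IsDiffFun.isDiffOpOfOrder (hk w), fun v => (hl v).isDiffOpOfOrder⟩

/-- Commutators are computed componentwise, so a bound common to all components suffices even for
infinite `ι`. This is where uniformity of the order is needed. -/
theorem isDiffOpOfOrder_pi {ι : Type*} : ∀ {k} {D : V →ₗ[ℂ] (ι → W)},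
    (∀ i, IsDiffOpOfOrder A k (LinearMap.proj i ∘ₗ D)) → IsDiffOpOfOrder A k D
  | 0, D, h => fun f => by
    ext v i
    exact LinearMap.congr_fun (h i f) v
  | _ + 1, D, h => fun f => isDiffOpOfOrder_pi fun i => h i f

theorem isDiffOpOfOrder_of_subtype_comp {L : Submodule A W} : ∀ {k} {D : V →ₗ[ℂ] L},
    IsDiffOpOfOrder A k ((L.subtype.restrictScalars ℂ) ∘ₗ D) → IsDiffOpOfOrder A k D
  | 0, D, h => fun f => by
    ext v
    exact LinearMap.congr_fun (h f) v
  | _ + 1, D, h => fun f => isDiffOpOfOrder_of_subtype_comp (h f)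

/-- A linear summation of a family of differential operators of uniformly bounded order is a
differential operator. -/
theorem IsDiffFun.linear_sum {ι : Type*} {L : Submodule A (ι → W)} (σ : L →ₗ[A] U) {k : ℕ}
    {D : ι → V → W} (h : ∀ i, IsDiffFun A k (D i)) (hL : ∀ v, (fun i => D i v) ∈ L) :
    IsDiffFun A k (fun v => σ ⟨fun i => D i v, hL v⟩) := by
  choose D' hD' hD using h
  let G : V →ₗ[ℂ] L :=
    { toFun := fun v => ⟨fun i => D i v, hL v⟩
      map_add' := fun v w => by ext i; simp [← hD]
      map_smul' := fun c v => by ext i; simp [← hD] }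
  have hG : IsDiffOpOfOrder A k G := by
    refine isDiffOpOfOrder_of_subtype_comp (isDiffOpOfOrder_pi fun i => ?_)
    convert hD' i using 1
    ext v
    exact (hD i v).symm
  exact (((IsDiffFun.linear σ).comp hG.isDiffFun).mono (zero_add k).le).congr fun v => rfl

end DiffFun

/-! ### Formal power series and maps linear in the formal parameter. -/

section Formal

variable {V : Type*} [AddCommGroup V] {W : Type*} [AddCommGroup W] {U : Type*} [AddCommGroup U]

/-- The constant formal series `v`. -/
def fconst (v : V) : FormalSeries V
  | 0 => v
  | _ + 1 => 0

/-- Multiplication by the formal parameter. -/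
def fshift (v : FormalSeries V) : FormalSeries V
  | 0 => 0
  | n + 1 => v n

@[simp] theorem fconst_apply_zero (v : V) : fconst v 0 = v := rfl
@[simp] theorem fconst_apply_succ (v : V) (n : ℕ) : fconst v (n + 1) = 0 := rfl
@[simp] theorem fshift_apply_zero (v : FormalSeries V) : fshift v 0 = 0 := rfl
@[simp] theorem fshift_apply_succ (v : FormalSeries V) (n : ℕ) : fshift v (n + 1) = v n := rfl

theorem fconst_zero : fconst (0 : V) = 0 := by
  ext n
  cases n <;> rfl

theorem eq_fconst_add_fshift (v : FormalSeries V) :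
    v = fconst (v 0) + fshift (fun n => v (n + 1)) := by
  ext n
  cases n <;> simp

theorem fshift_sub (v w : FormalSeries V) : fshift (v - w) = fshift v - fshift w := by
  ext n
  cases n <;> simp

/-- Additive maps of formal series that commute with multiplication by the formal parameter. -/
structure IsFormal (G : FormalSeries V → FormalSeries W) : Prop where
  map_add : ∀ v w, G (v + w) = G v + G w
  map_shift : ∀ v, G (fshift v) = fshift (G v)

namespace IsFormal

variable {G H : FormalSeries V → FormalSeries W}

theorem map_zero (h : IsFormal G) : G 0 = 0 := by
  simpa using h.map_add 0 0

theorem map_sub (h : IsFormal G) (v w : FormalSeries V) : G (v - w) = G v - G w := by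
  have := h.map_add (v - w) w
  rw [sub_add_cancel] at this
  rw [this, add_sub_cancel_right]

theorem id : IsFormal (fun v : FormalSeries V => v) := ⟨fun _ _ => rfl, fun _ => rfl⟩

theorem comp {G : FormalSeries W → FormalSeries U} {H : FormalSeries V → FormalSeries W}
    (hG : IsFormal G) (hH : IsFormal H) : IsFormal (fun v => G (H v)) :=
  ⟨fun v w => by rw [hH.map_add, hG.map_add], fun v => by rw [hH.map_shift, hG.map_shift]⟩

theorem sub (hG : IsFormal G) (hH : IsFormal H) : IsFormal (fun v => G v - H v) :=
  ⟨fun v w => by rw [hG.map_add, hH.map_add]; abel,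
    fun v => by rw [hG.map_shift, hH.map_shift, fshift_sub]⟩

theorem apply_succ (h : IsFormal G) (v : FormalSeries V) (n : ℕ) :
    G v (n + 1) = G (fconst (v 0)) (n + 1) + G (fun n => v (n + 1)) n := by
  conv_lhs => rw [eq_fconst_add_fshift v, h.map_add, h.map_shift]
  simp

theorem apply_zero (h : IsFormal G) (v : FormalSeries V) : G v 0 = G (fconst (v 0)) 0 := by
  conv_lhs => rw [eq_fconst_add_fshift v, h.map_add, h.map_shift]
  simp

theorem apply_eq_zero (h : IsFormal G) {n : ℕ} (hn : ∀ v, ∀ k < n, G (fconst v) k = 0)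
    (v : FormalSeries V) (k : ℕ) (hk : k < n) : G v k = 0 := by
  induction k generalizing v with
  | zero => rw [h.apply_zero, hn _ _ hk]
  | succ k ih => rw [h.apply_succ, hn _ _ hk, ih _ (by omega), add_zero]

/-- Split `v` into its constant term plus `λ` times a remainder: if `G` is divisible by `λ ^ n`, the
remainder contributes only from degree `n + 1` on. -/
theorem apply_eq (h : IsFormal G) {n : ℕ} (hn : ∀ v, ∀ k < n, G (fconst v) k = 0)
    (v : FormalSeries V) : G v n = G (fconst (v 0)) n := by
  cases n with
  | zero => exact h.apply_zero v
  | succ n => rw [h.apply_succ, h.apply_eq_zero hn _ _ n.lt_succ_self, add_zero]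

end IsFormal

theorem sum_antidiagonal_fconst {X : Type*} [AddCommMonoid X] (b : V) (n : ℕ)
    (g : ℕ → V → X) (hg : ∀ k, g k 0 = 0) :
    ∑ p ∈ Finset.HasAntidiagonal.antidiagonal n, g p.1 (fconst b p.2) = g n b := by
  cases n with
  | zero => simp
  | succ n => simp [Finset.Nat.sum_antidiagonal_succ', hg]

variable [Module ℂ V] [Module ℂ W] [Module ℂ U]
  {B : ℕ → V →ₗ[ℂ] W →ₗ[ℂ] U} {T : ℕ → V →ₗ[ℂ] W}

theorem isFormal_formalBilin_left (B : ℕ → V →ₗ[ℂ] W →ₗ[ℂ] U) (w : FormalSeries W) :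
    IsFormal (fun v => formalBilin B v w) where
  map_add v v' := by
    ext n
    simp [formalBilin, Finset.sum_add_distrib]
  map_shift v := by
    ext n
    cases n with
    | zero => simp [formalBilin]
    | succ n =>
      simp [formalBilin, Finset.Nat.sum_antidiagonal_succ' (n := n),
        Finset.Nat.sum_antidiagonal_succ]

theorem isFormal_formalBilin_right (B : ℕ → V →ₗ[ℂ] W →ₗ[ℂ] U) (v : FormalSeries V) :
    IsFormal (fun w => formalBilin B v w) where
  map_add w w' := by
    ext n
    simp [formalBilin, Finset.sum_add_distrib]
  map_shift w := by
    ext n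
    cases n with
    | zero => simp [formalBilin]
    | succ n =>
      simp [formalBilin, Finset.Nat.sum_antidiagonal_succ']

theorem isFormal_formalLin (T : ℕ → V →ₗ[ℂ] W) : IsFormal (formalLin T) where
  map_add w w' := by
    ext n
    simp [formalLin, Finset.sum_add_distrib]
  map_shift w := by
    ext n
    cases n with
    | zero => simp [formalLin]
    | succ n => simp [formalLin, Finset.Nat.sum_antidiagonal_succ']

theorem formalBilin_apply_zero (v : FormalSeries V) (w : FormalSeries W) :
    formalBilin B v w 0 = B 0 (v 0) (w 0) := by
  simp [formalBilin]

theorem formalLin_apply_zero (v : FormalSeries V) : formalLin T v 0 = T 0 (v 0) := by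
  simp [formalLin]

theorem formalBilin_fconst_right (v : FormalSeries V) (w : W) (n : ℕ) :
    formalBilin B v (fconst w) n =
      ∑ p ∈ Finset.HasAntidiagonal.antidiagonal n, B p.1 (v p.2) w := by
  refine Finset.sum_congr rfl fun p _ => ?_
  exact sum_antidiagonal_fconst w p.2 (fun k x => B p.1 (v k) x) (by simp)

theorem formalBilin_fconst_left (v : V) (w : FormalSeries W) (n : ℕ) :
    formalBilin B (fconst v) w n =
      ∑ p ∈ Finset.HasAntidiagonal.antidiagonal n, B p.1 v (w p.2) := by
  refine Finset.sum_congr rfl fun p _ => ?_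
  rw [← Finset.Nat.sum_antidiagonal_swap]
  exact sum_antidiagonal_fconst v p.2 (fun k x => B p.1 x (w k)) (by simp)

theorem formalBilin_fconst (v : V) (w : W) (n : ℕ) :
    formalBilin B (fconst v) (fconst w) n = B n v w := by
  rw [formalBilin_fconst_left]
  exact sum_antidiagonal_fconst w n (fun k x => B k v x) (by simp)

theorem formalLin_fconst (v : V) (n : ℕ) : formalLin T (fconst v) n = T n v :=
  sum_antidiagonal_fconst v n (fun k x => T k x) (by simp)

theorem formalBilin_congr {B B' : ℕ → V →ₗ[ℂ] W →ₗ[ℂ] U} {v v' : FormalSeries V}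
    {w w' : FormalSeries W} {n : ℕ} (hB : ∀ k ≤ n, B k = B' k) (hv : ∀ k ≤ n, v k = v' k)
    (hw : ∀ k ≤ n, w k = w' k) {k : ℕ} (hk : k ≤ n) :
    formalBilin B v w k = formalBilin B' v' w' k := by
  refine Finset.sum_congr rfl fun p hp => Finset.sum_congr rfl fun q hq => ?_
  rw [Finset.HasAntidiagonal.mem_antidiagonal] at hp hq
  rw [hB _ (by omega), hv _ (by omega), hw _ (by omega)]

theorem formalLin_congr {T T' : ℕ → V →ₗ[ℂ] W} {v v' : FormalSeries V} {n : ℕ}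
    (hT : ∀ k ≤ n, T k = T' k) (hv : ∀ k ≤ n, v k = v' k) {k : ℕ} (hk : k ≤ n) :
    formalLin T v k = formalLin T' v' k := by
  refine Finset.sum_congr rfl fun p hp => ?_
  rw [Finset.HasAntidiagonal.mem_antidiagonal] at hp
  rw [hT _ (by omega), hv _ (by omega)]

/-- Changing the `n`-th coefficient changes the values in degree `n` only through the lowest
coefficients of the arguments. -/
theorem formalBilin_update (B : ℕ → V →ₗ[ℂ] W →ₗ[ℂ] U) (n : ℕ) (x : V →ₗ[ℂ] W →ₗ[ℂ] U)
    (v : FormalSeries V) (w : FormalSeries W) :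
    formalBilin (Function.update B n x) v w n =
      formalBilin (Function.update B n 0) v w n + x (v 0) (w 0) := by
  cases n with
  | zero => simp [formalBilin]
  | succ n =>
    simp only [formalBilin, Finset.Nat.sum_antidiagonal_succ' (n := n), Function.update_self,
      LinearMap.zero_apply, Finset.Nat.antidiagonal_zero, Finset.sum_singleton, zero_add]
    rw [add_comm]
    congr 1
    refine Finset.sum_congr rfl fun p hp => ?_
    rw [Finset.HasAntidiagonal.mem_antidiagonal] at hp
    rw [Function.update_of_ne (by omega), Function.update_of_ne (by omega)]

theorem formalLin_update (T : ℕ → V →ₗ[ℂ] W) (n : ℕ) (x : V →ₗ[ℂ] W) (v : FormalSeries V) :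
    formalLin (Function.update T n x) v n = formalLin (Function.update T n 0) v n + x (v 0) := by
  cases n with
  | zero => simp [formalLin]
  | succ n =>
    simp only [formalLin, Finset.Nat.sum_antidiagonal_succ' (n := n), Function.update_self,
      LinearMap.zero_apply, zero_add]
    rw [add_comm]
    congr 1
    refine Finset.sum_congr rfl fun p hp => ?_
    rw [Finset.HasAntidiagonal.mem_antidiagonal] at hp
    rw [Function.update_of_ne (by omega), Function.update_of_ne (by omega)]

theorem formalBilin_update_of_lt (B : ℕ → V →ₗ[ℂ] W →ₗ[ℂ] U) {n k : ℕ} (hk : k < n)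
    (x y : V →ₗ[ℂ] W →ₗ[ℂ] U) (v : FormalSeries V) (w : FormalSeries W) :
    formalBilin (Function.update B n x) v w k = formalBilin (Function.update B n y) v w k := by
  refine formalBilin_congr (n := k) (fun l hl => ?_) (fun _ _ => rfl) (fun _ _ => rfl) le_rfl
  rw [Function.update_of_ne (by omega), Function.update_of_ne (by omega)]

theorem formalLin_update_of_lt (T : ℕ → V →ₗ[ℂ] W) {n k : ℕ} (hk : k < n)
    (x y : V →ₗ[ℂ] W) (v : FormalSeries V) :
    formalLin (Function.update T n x) v k = formalLin (Function.update T n y) v k := by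
  refine formalLin_congr (n := k) (fun l hl => ?_) (fun _ _ => rfl) le_rfl
  rw [Function.update_of_ne (by omega), Function.update_of_ne (by omega)]

/-- A formal series starting in degree `n` only sees the lowest coefficients in degree `n`. -/
theorem formalBilin_eq_of_lowest {v v' : FormalSeries V} {n : ℕ} (h : ∀ k < n, v k = v' k)
    (w : FormalSeries W) :
    formalBilin B v w n = formalBilin B v' w n + B 0 (v n - v' n) (w 0) := by
  have key : ∀ u : FormalSeries V, (∀ k < n, u k = 0) →
      formalBilin B u w n = B 0 (u n) (w 0) := by
    intro u hu
    unfold formalBilin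
    rw [Finset.sum_eq_single (0, n)]
    · rw [Finset.sum_eq_single (n, 0)]
      · rintro ⟨a, b⟩ hq hne
        simp only [Finset.HasAntidiagonal.mem_antidiagonal] at hq
        rw [hu a (by
          rcases Nat.lt_or_ge a n with h | h
          · exact h
          · exact absurd (Prod.ext (by simp; omega) (by simp; omega)) hne)]
        simp
      · simp
    · rintro ⟨a, b⟩ hp hne
      simp only [Finset.HasAntidiagonal.mem_antidiagonal] at hp
      refine Finset.sum_eq_zero fun q hq => ?_
      simp only [Finset.HasAntidiagonal.mem_antidiagonal] at hq
      rw [hu q.1 (by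
        rcases Nat.eq_zero_or_pos a with h | h
        · exact absurd (Prod.ext (by simpa using h) (by simp; omega)) hne
        · omega)]
      simp
    · simp
  have := key (v - v') (fun k hk => by simp [h k hk])
  rw [(isFormal_formalBilin_left B w).map_sub] at this
  rw [← Pi.sub_apply, ← this, Pi.sub_apply, add_sub_cancel]

/-- Recursive construction of a sequence whose finite parts satisfy given properties. -/
theorem exists_seq_of_step {X : Type*} [Nonempty X] (P : ℕ → (ℕ → X) → Prop)
    (hP : ∀ n R R', (∀ k ≤ n, R k = R' k) → P n R → P n R')
    (step : ∀ n R, (∀ k < n, P k R) → ∃ x, P n (Function.update R n x)) :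
    ∃ R, ∀ n, P n R := by
  classical
  choose! x hx using step
  -- In the `n`-th approximation the entries below `n` are final; all others still hold the
  -- arbitrary default.
  let Q : ℕ → ℕ → X := fun n => Nat.rec (fun _ => Classical.arbitrary X)
    (fun n R => Function.update R n (x n R)) n
  have hQ : ∀ n, Q (n + 1) = Function.update (Q n) n (x n (Q n)) := fun n => rfl
  have hstab : ∀ k n, k < n → Q n k = Q (k + 1) k := by
    intro k n hkn
    induction n with
    | zero => omega
    | succ n ih =>
      rcases Nat.lt_or_ge k n with h | h
      · rw [hQ, Function.update_of_ne (by omega), ih h]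
      · obtain rfl : k = n := by omega
        rfl
  have hPQ : ∀ n k, k < n → P k (Q n) := by
    intro n
    induction n with
    | zero => intro k hk; omega
    | succ n ih =>
      intro k hk
      rcases Nat.lt_or_ge k n with h | h
      · refine hP k (Q n) _ (fun l hl => ?_) (ih k h)
        rw [hQ, Function.update_of_ne (by omega)]
      · obtain rfl : k = n := by omega
        rw [hQ]
        exact hx k _ ih
  -- Entry `n` becomes final at stage `n + 1`, which explains the shift in the diagonal sequence.
  refine ⟨fun n => Q (n + 1) n, fun n => hP n (Q (n + 1)) _ (fun k hk => ?_) (hPQ _ _ n.lt_succ_self)⟩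
  exact hstab k (n + 1) (by omega)

end Formal

/-! ### Lowest-order terms of multilinear formal expressions. -/

section Multi

variable {V : Type*} [AddCommGroup V] {W : Type*} [AddCommGroup W] {X : Type*} [AddCommGroup X]
  {U : Type*} [AddCommGroup U]

/-- Reduces identities between formal series to identities on constant series: the lowest term is
extracted in one variable at a time. -/
theorem formal_two_lowest {D : FormalSeries V → FormalSeries W → FormalSeries U}
    (h₁ : ∀ w, IsFormal (fun v => D v w)) (h₂ : ∀ v, IsFormal (fun w => D v w)) {n : ℕ}
    (hn : ∀ v w, ∀ k < n, D (fconst v) (fconst w) k = 0) :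
    (∀ v w, ∀ k < n, D v w k = 0) ∧ ∀ v w, D v w n = D (fconst (v 0)) (fconst (w 0)) n := by
  have a : ∀ v w, ∀ k < n, D (fconst v) w k = 0 := fun v w =>
    (h₂ (fconst v)).apply_eq_zero (hn v) w
  refine ⟨fun v w => (h₁ w).apply_eq_zero (fun v => a v w) v, fun v w => ?_⟩
  rw [(h₁ w).apply_eq (fun v => a v w) v, (h₂ _).apply_eq (hn _) w]

theorem formal_three_lowest
    {D : FormalSeries V → FormalSeries W → FormalSeries X → FormalSeries U}
    (h₁ : ∀ w x, IsFormal (fun v => D v w x)) (h₂ : ∀ v x, IsFormal (fun w => D v w x))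
    (h₃ : ∀ v w, IsFormal (fun x => D v w x)) {n : ℕ}
    (hn : ∀ v w x, ∀ k < n, D (fconst v) (fconst w) (fconst x) k = 0) :
    (∀ v w x, ∀ k < n, D v w x k = 0) ∧
      ∀ v w x, D v w x n = D (fconst (v 0)) (fconst (w 0)) (fconst (x 0)) n := by
  have a := fun v => formal_two_lowest (h₂ (fconst v)) (h₃ (fconst v)) (hn v)
  refine ⟨fun v w x => (h₁ w x).apply_eq_zero (fun v => (a v).1 w x) v, fun v w x => ?_⟩
  rw [(h₁ w x).apply_eq (fun v => (a v).1 w x) v, (a _).2]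

/-- A formal deformation of the identity that is idempotent is the identity. -/
theorem IsFormal.eq_self_of_idempotent {P : FormalSeries V → FormalSeries V} (hP : IsFormal P)
    (h₀ : ∀ φ, P φ 0 = φ 0) (hPP : ∀ φ, P (P φ) = P φ) (φ : FormalSeries V) : P φ = φ := by
  have hQ : IsFormal (fun φ => P φ - φ) := hP.sub .id
  have key : ∀ n, ∀ φ, (P φ - φ) n = 0 := by
    intro n
    induction n using Nat.strong_induction_on with
    | _ n ih =>
      intro φ
      -- `P - id` vanishes below degree `n`, so its degree `n` part sees only constant terms. The
      -- series `P φ - φ` has constant term zero and is killed by `P`, so `P - id` sends it to its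
      -- negative.
      have h1 := hQ.apply_eq (n := n) (fun v k hk => ih k hk _) (P φ - φ)
      have h2 : P (P φ - φ) = 0 := by rw [hP.map_sub, hPP, sub_self]
      have h3 : (P φ - φ) 0 = 0 := by simp [h₀]
      rw [h2, h3, fconst_zero, hP.map_zero] at h1
      have h4 : φ n - P φ n = 0 := by simpa using h1
      rw [Pi.sub_apply, ← neg_sub, h4, neg_zero]
  exact sub_eq_zero.1 (funext fun n => key n φ)

end Multi

/-- A locally finite frame of the `A`-module `Γ`: elements `s i` of `Γ` and `A`-linear forms `ξ i`
such that `φ = ∑ i, ξ i φ • s i`, where the sum is defined on a submodule of families that contains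
the images of `ξ i φ` and `ξ i φ • s i` under arbitrary differential operators, and commutes with
differential operators. -/
structure LocallyFiniteFrame (A : Type*) [CommRing A] [Algebra ℂ A] (Γ : Type*) [AddCommGroup Γ]
    [Module ℂ Γ] [Module A Γ] [IsScalarTower ℂ A Γ] (ι : Type*) where
  s : ι → Γ
  ξ : ι → Γ →ₗ[A] A
  summable : Submodule A (ι → Γ)
  sum : summable →ₗ[A] Γ
  mem : ∀ D : ι → A → Γ, (∀ i, ∃ k, IsDiffFun A k (D i)) →
    ∀ φ, (fun i => D i (ξ i φ)) ∈ summable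
  sum_eq : ∀ D : Γ → Γ, (∃ k, IsDiffFun A k D) →
    ∀ φ (h : (fun i => D (ξ i φ • s i)) ∈ summable), sum ⟨_, h⟩ = D φ

variable {A : Type*} [CommRing A] [Algebra ℂ A] {Γ : Type*} [AddCommGroup Γ] [Module ℂ Γ]

/-! ### The obstruction to a right module structure. -/

section Defect

variable {S : StarProduct A}

/-- The defect of `∑ r, λ ^ r R r` to be a right module structure. -/
def moduleDefect (S : StarProduct A) (R : ℕ → Γ →ₗ[ℂ] A →ₗ[ℂ] Γ) (φ : FormalSeries Γ)
    (f g : FormalSeries A) : FormalSeries Γ :=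
  formalBilin R φ (S.mul f g) - formalBilin R (formalBilin R φ f) g

variable (R : ℕ → Γ →ₗ[ℂ] A →ₗ[ℂ] Γ)

theorem isFormal_moduleDefect₁ (f g : FormalSeries A) :
    IsFormal (fun φ => moduleDefect S R φ f g) :=
  (isFormal_formalBilin_left R _).sub
    ((isFormal_formalBilin_left R g).comp (isFormal_formalBilin_left R f))

theorem isFormal_moduleDefect₂ (φ : FormalSeries Γ) (g : FormalSeries A) :
    IsFormal (fun f => moduleDefect S R φ f g) :=
  ((isFormal_formalBilin_right R φ).comp (isFormal_formalBilin_left S.C g)).sub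
    ((isFormal_formalBilin_left R g).comp (isFormal_formalBilin_right R φ))

theorem isFormal_moduleDefect₃ (φ : FormalSeries Γ) (f : FormalSeries A) :
    IsFormal (fun g => moduleDefect S R φ f g) :=
  ((isFormal_formalBilin_right R φ).comp (isFormal_formalBilin_right S.C f)).sub
    (isFormal_formalBilin_right R _)

/-- Holds for arbitrary `R`: everything cancels by associativity of `⋆`. Its lowest-degree part is
the Hochschild 2-cocycle equation. -/
theorem moduleDefect_cocycle (φ : FormalSeries Γ) (f g h : FormalSeries A) :
    moduleDefect S R (formalBilin R φ f) g h - moduleDefect S R φ (S.mul f g) h +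
      moduleDefect S R φ f (S.mul g h) - formalBilin R (moduleDefect S R φ f g) h = 0 := by
  have := (isFormal_formalBilin_left R h).map_sub (formalBilin R φ (S.mul f g))
    (formalBilin R (formalBilin R φ f) g)
  have hS : S.mul (S.mul f g) h = S.mul f (S.mul g h) := S.assoc f g h
  simp only [moduleDefect, this, hS]
  abel

variable {R} in
theorem moduleDefect_congr {R' : ℕ → Γ →ₗ[ℂ] A →ₗ[ℂ] Γ} {n : ℕ} (h : ∀ k ≤ n, R k = R' k)
    (φ : FormalSeries Γ) (f g : FormalSeries A) :
    moduleDefect S R φ f g n = moduleDefect S R' φ f g n := by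
  simp only [moduleDefect, Pi.sub_apply]
  rw [formalBilin_congr h (fun _ _ => rfl) (fun _ _ => rfl) le_rfl,
    formalBilin_congr h
      (fun k hk => formalBilin_congr h (fun _ _ => rfl) (fun _ _ => rfl) hk) (fun _ _ => rfl) le_rfl]

theorem moduleDefect_fconst (n : ℕ) (φ : Γ) (f g : A) :
    moduleDefect S R (fconst φ) (fconst f) (fconst g) n =
      (∑ p ∈ Finset.HasAntidiagonal.antidiagonal n, R p.1 φ (S.C p.2 f g)) -
        ∑ p ∈ Finset.HasAntidiagonal.antidiagonal n, R p.1 (R p.2 φ f) g := by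
  simp only [moduleDefect, Pi.sub_apply, StarProduct.mul]
  rw [formalBilin_fconst_left, formalBilin_fconst_right]
  simp only [formalBilin_fconst]

end Defect

variable [Module A Γ] [IsScalarTower ℂ A Γ] {ι : Type*}

theorem LocallyFiniteFrame.mem_smul (fr : LocallyFiniteFrame A Γ ι) {D : Γ → Γ}
    (hD : ∃ k, IsDiffFun A k D) (φ : Γ) : (fun i => D (fr.ξ i φ • fr.s i)) ∈ fr.summable := by
  obtain ⟨k, hD⟩ := hD
  exact fr.mem (fun i f => D (f • fr.s i))
    (fun i => ⟨_, hD.comp (IsDiffFun.linear (LinearMap.toSpanSingleton A Γ (fr.s i)))⟩) φ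

/-! ### Existence of deformation quantizations. -/

section Existence

variable {S : StarProduct A} {R : ℕ → Γ →ₗ[ℂ] A →ₗ[ℂ] Γ}

theorem moduleDefect_diff₁ {n : ℕ} (hR : ∀ k ≤ n, IsBidiffOp A (R k)) :
    IsDiffFamily A (fun (x : A × A) (φ : Γ) =>
      moduleDefect S R (fconst φ) (fconst x.1) (fconst x.2) n) := by
  simp only [moduleDefect_fconst]
  refine (IsDiffFamily.sum _ fun p hp => ?_).sub (IsDiffFamily.sum _ fun p hp => ?_) <;>
    rw [Finset.HasAntidiagonal.mem_antidiagonal] at hp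
  · exact (isBidiffOp_iff.1 (hR p.1 (by omega))).1.reparam (fun x : A × A => S.C p.2 x.1 x.2)
  · exact (isBidiffOp_iff.1 (hR p.1 (by omega))).1.comp
      ((isBidiffOp_iff.1 (hR p.2 (by omega))).1.reparam Prod.fst) Prod.snd

theorem moduleDefect_diff₂ {n : ℕ} (hR : ∀ k ≤ n, IsBidiffOp A (R k)) :
    IsDiffFamily A (fun (x : Γ × A) (f : A) =>
      moduleDefect S R (fconst x.1) (fconst f) (fconst x.2) n) := by
  simp only [moduleDefect_fconst]
  refine (IsDiffFamily.sum _ fun p hp => ?_).sub (IsDiffFamily.sum _ fun p hp => ?_) <;>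
    rw [Finset.HasAntidiagonal.mem_antidiagonal] at hp
  · exact (isBidiffOp_iff.1 (hR p.1 (by omega))).2.comp
      ((isBidiffOp_iff.1 (S.isBidiffOp p.2)).1.reparam Prod.snd) Prod.fst
  · exact (isBidiffOp_iff.1 (hR p.1 (by omega))).1.comp
      ((isBidiffOp_iff.1 (hR p.2 (by omega))).2.reparam Prod.fst) Prod.snd

theorem moduleDefect_diff₃ {n : ℕ} (hR : ∀ k ≤ n, IsBidiffOp A (R k)) :
    IsDiffFamily A (fun (x : Γ × A) (g : A) =>
      moduleDefect S R (fconst x.1) (fconst x.2) (fconst g) n) := by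
  simp only [moduleDefect_fconst]
  refine (IsDiffFamily.sum _ fun p hp => ?_).sub (IsDiffFamily.sum _ fun p hp => ?_) <;>
    rw [Finset.HasAntidiagonal.mem_antidiagonal] at hp
  · exact (isBidiffOp_iff.1 (hR p.1 (by omega))).2.comp
      ((isBidiffOp_iff.1 (S.isBidiffOp p.2)).2.reparam Prod.snd) Prod.fst
  · exact (isBidiffOp_iff.1 (hR p.1 (by omega))).2.reparam (fun x : Γ × A => R p.2 x.1 x.2)

/-- Hochschild `2`-cocycles with values in differential operators on `Γ` are coboundaries. -/
theorem exists_bidiff_primitive (fr : LocallyFiniteFrame A Γ ι) {E : Γ → A → A → Γ}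
    (h₁ : IsDiffFamily A (fun (x : A × A) φ => E φ x.1 x.2))
    (h₂ : IsDiffFamily A (fun (x : Γ × A) f => E x.1 f x.2))
    (h₃ : IsDiffFamily A (fun (x : Γ × A) g => E x.1 x.2 g))
    (hE : ∀ φ f g h, E (f • φ) g h - E φ (f * g) h + E φ f (g * h) - h • E φ f g = 0) :
    ∃ x : Γ →ₗ[ℂ] A →ₗ[ℂ] Γ, IsBidiffOp A x ∧
      ∀ φ f g, E φ f g = x (f • φ) g - x φ (f * g) + g • x φ f := by
  -- The primitive will be `x(φ, f) = ∑ E(s i, ξ i φ, f)`. Since `ξ i` is `A`-linear, its order in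
  -- `φ` is bounded by that of `E` in its second slot.
  have hmem : ∀ φ f, (fun i => E (fr.s i) (fr.ξ i φ) f) ∈ fr.summable := fun φ f =>
    fr.mem (fun i a => E (fr.s i) a f) (fun i => h₂.isDiffFun (fr.s i, f)) φ
  obtain ⟨k, hk⟩ := h₂
  obtain ⟨l, hl⟩ := h₃
  have d₁ : ∀ f, IsDiffFun A k (fun φ => fr.sum ⟨_, hmem φ f⟩) := fun f =>
    IsDiffFun.linear_sum fr.sum (D := fun i φ => E (fr.s i) (fr.ξ i φ) f)
      (fun i => (hk (fr.s i, f)).comp (IsDiffFun.linear (fr.ξ i))) (fun φ => hmem φ f)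
  have d₂ : ∀ φ, IsDiffFun A l (fun f => fr.sum ⟨_, hmem φ f⟩) := fun φ =>
    IsDiffFun.linear_sum fr.sum (D := fun i f => E (fr.s i) (fr.ξ i φ) f)
      (fun i => hl (fr.s i, fr.ξ i φ)) (fun f => hmem φ f)
  refine ⟨LinearMap.mk₂ ℂ (fun φ f => fr.sum ⟨_, hmem φ f⟩) (fun φ ψ f => (d₁ f).map_add φ ψ)
    (fun c φ f => (d₁ f).map_smul c φ) (fun φ f g => (d₂ φ).map_add f g)
    (fun c φ f => (d₂ φ).map_smul c f), isBidiffOp_iff.2 ⟨⟨k, d₁⟩, ⟨l, d₂⟩⟩, fun φ f g => ?_⟩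
  simp only [LinearMap.mk₂_apply]
  -- Expand `E φ f g` as `∑ E(ξ i φ • s i, f, g)`; the claim then holds termwise, by the cocycle
  -- equation at `s i, ξ i φ, f, g`.
  rw [← fr.sum_eq (fun φ => E φ f g) (h₁.isDiffFun (f, g)) φ
    (fr.mem_smul (h₁.isDiffFun (f, g)) φ), ← map_smul, ← map_sub, ← map_add]
  congr 1
  ext i
  have hξ : fr.ξ i (f • φ) = fr.ξ i φ * f := by rw [map_smul, smul_eq_mul, mul_comm]
  simp only [Submodule.coe_add, Submodule.coe_sub, Submodule.coe_smul, Pi.add_apply, Pi.sub_apply,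
    Pi.smul_apply, hξ]
  rw [← sub_eq_zero, ← hE (fr.s i) (fr.ξ i φ) f g]
  abel

variable (A Γ) in
/-- The given right module structure. -/
noncomputable def rsmul : Γ →ₗ[ℂ] A →ₗ[ℂ] Γ := (Algebra.lsmul ℂ ℂ Γ).toLinearMap.flip

@[simp] theorem rsmul_apply (φ : Γ) (f : A) : rsmul A Γ φ f = f • φ := rfl

theorem isBidiffOp_rsmul : IsBidiffOp A (rsmul A Γ) :=
  isBidiffOp_iff.2 ⟨⟨0, fun f => IsDiffFun.linear (LinearMap.lsmul A Γ f)⟩,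
    ⟨0, fun φ => IsDiffFun.linear (LinearMap.toSpanSingleton A Γ φ)⟩⟩

theorem isBidiffOp_zero : IsBidiffOp A (0 : Γ →ₗ[ℂ] A →ₗ[ℂ] Γ) :=
  isBidiffOp_iff.2 ⟨.zero, .zero⟩

/-- The right module structure can be deformed from order `n - 1` to order `n`. -/
theorem exists_next_module_coeff (fr : LocallyFiniteFrame A Γ ι) (S : StarProduct A) {n : ℕ}
    (hn : 0 < n) (hR₀ : R 0 = rsmul A Γ) (hR : ∀ k < n, IsBidiffOp A (R k))
    (hdef : ∀ k < n, ∀ φ f g, moduleDefect S R (fconst φ) (fconst f) (fconst g) k = 0) :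
    ∃ x : Γ →ₗ[ℂ] A →ₗ[ℂ] Γ, IsBidiffOp A x ∧ ∀ φ f g,
      moduleDefect S (Function.update R n x) (fconst φ) (fconst f) (fconst g) n = 0 := by
  -- With coefficient `n` set to zero, the degree `n` defect is the part independent of the unknown
  -- `x`.
  set Q := Function.update R n 0 with hQdef
  have hQ₀ : Q 0 = rsmul A Γ := by rw [hQdef, Function.update_of_ne hn.ne, hR₀]
  have hQ : ∀ k ≤ n, IsBidiffOp A (Q k) := fun k hk => by
    rcases hk.lt_or_eq with h | rfl
    · rw [hQdef, Function.update_of_ne h.ne]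
      exact hR k h
    · rw [hQdef, Function.update_self]
      exact isBidiffOp_zero
  obtain ⟨hlt, heq⟩ := formal_three_lowest (isFormal_moduleDefect₁ (S := S) Q)
    (isFormal_moduleDefect₂ Q) (isFormal_moduleDefect₃ Q) (n := n) (fun φ f g k hk => by
      rw [← hdef k hk φ f g]
      refine moduleDefect_congr (fun l hl => ?_) _ _ _
      rw [hQdef, Function.update_of_ne (by omega)])
  obtain ⟨x, hx, hEx⟩ := exists_bidiff_primitive fr
    (E := fun φ f g => moduleDefect S Q (fconst φ) (fconst f) (fconst g) n) (moduleDefect_diff₁ (S := S) hQ) (moduleDefect_diff₂ hQ) (moduleDefect_diff₃ hQ) (by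
      intro φ f g h
      have := congrFun (moduleDefect_cocycle (S := S) Q (fconst φ) (fconst f) (fconst g) (fconst h)) n
      -- The defect starts in degree `n`, so in the cocycle identity `φ • f`, `f ⋆ g` and the outer
      -- action may be replaced by their undeformed versions.
      have low := formalBilin_eq_of_lowest (B := Q) (n := n)
        (v := moduleDefect S Q (fconst φ) (fconst f) (fconst g)) (v' := 0)
        (fun k hk => hlt _ _ _ k hk) (fconst h)
      rw [(isFormal_formalBilin_left Q (fconst h)).map_zero] at low
      simp only [Pi.add_apply, Pi.sub_apply, Pi.zero_apply] at this
      rw [low, heq (formalBilin Q _ _), heq _ (S.mul _ _), heq _ _ (S.mul _ _)] at this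
      simpa [StarProduct.mul, formalBilin_apply_zero, hQ₀, S.C_zero] using this)
  refine ⟨x, hx, fun φ f g => ?_⟩
  have key := hEx φ f g
  set R' := Function.update R n x with hR'def
  have hR'₀ : R' 0 = rsmul A Γ := by rw [hR'def, Function.update_of_ne hn.ne, hR₀]
  -- In `(φ • f) • g` the unknown enters twice: in the outer action as `x(f φ, g)`, and in the inner
  -- one as `g x(φ, f)`, which is the term isolated here.
  have low := formalBilin_eq_of_lowest (B := Q) (n := n)
    (v := formalBilin R' (fconst φ) (fconst f)) (v' := formalBilin Q (fconst φ) (fconst f))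
    (fun k hk => formalBilin_update_of_lt R hk _ _ _ _) (fconst g)
  simp only [moduleDefect, Pi.sub_apply] at key ⊢
  rw [formalBilin_update R n x (fconst φ), formalBilin_update R n x (formalBilin R' _ _), ← hQdef, low,
    formalBilin_update R n x (fconst φ) (fconst f), ← hQdef, formalBilin_apply_zero,
    StarProduct.mul, formalBilin_apply_zero, hR'₀, hQ₀, S.C_zero]
  simp only [fconst_apply_zero, rsmul_apply, add_sub_cancel_left]
  rw [StarProduct.mul] at key
  rw [sub_eq_iff_eq_add] at key
  rw [key]
  abel

theorem exists_deformationQuantization (fr : LocallyFiniteFrame A Γ ι) (S : StarProduct A) :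
    Nonempty (DeformationQuantization S Γ) := by
  obtain ⟨R, hR⟩ := exists_seq_of_step (X := Γ →ₗ[ℂ] A →ₗ[ℂ] Γ)
    (fun n R => R 0 = rsmul A Γ ∧ IsBidiffOp A (R n) ∧
      ∀ φ f g, moduleDefect S R (fconst φ) (fconst f) (fconst g) n = 0)
    (fun n R R' h hR => ⟨by rw [← h 0 n.zero_le, hR.1], by rw [← h n le_rfl]; exact hR.2.1,
      fun φ f g => by rw [← moduleDefect_congr h, hR.2.2]⟩)
    (fun n R hR => by
      rcases Nat.eq_zero_or_pos n with rfl | hn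
      · refine ⟨rsmul A Γ, by simp, by simpa using isBidiffOp_rsmul, fun φ f g => ?_⟩
        simp [moduleDefect, StarProduct.mul, formalBilin_apply_zero, S.C_zero, mul_smul,
          smul_comm f g]
      · obtain ⟨x, hx, h⟩ := exists_next_module_coeff fr S hn (hR 0 hn).1
          (fun k hk => (hR k hk).2.1) (fun k hk => (hR k hk).2.2)
        refine ⟨x, ?_, by simpa using hx, h⟩
        rw [Function.update_of_ne hn.ne, (hR 0 hn).1])
  have hR₀ : R 0 = rsmul A Γ := (hR 0).1
  have hmul : ∀ (φ : FormalSeries Γ) (f g : FormalSeries A),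
      formalBilin R φ (S.mul f g) = formalBilin R (formalBilin R φ f) g := fun φ f g => by
    rw [← sub_eq_zero]
    funext n
    exact (formal_three_lowest (isFormal_moduleDefect₁ (S := S) R) (isFormal_moduleDefect₂ R)
      (isFormal_moduleDefect₃ R) (n := n + 1) (fun φ f g k _ => (hR k).2.2 φ f g)).1 φ f g n
        n.lt_succ_self
  refine ⟨⟨R, fun φ f => by rw [hR₀, rsmul_apply], fun n => (hR n).2.1, hmul, fun e he φ => ?_⟩⟩
  -- Idempotence follows from `e ⋆ e = e`; the constant term of `e` is `1` because `C 0` is the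
  -- ordinary product.
  refine (isFormal_formalBilin_left R e).eq_self_of_idempotent (fun φ => ?_) (fun φ => ?_) φ
  · have h1 : e 0 = 1 := by
      have := congrFun (he (fconst 1)).1 0
      simpa [StarProduct.mul, formalBilin_apply_zero, S.C_zero] using this
    rw [formalBilin_apply_zero, hR₀, h1, rsmul_apply, one_smul]
  · rw [← hmul, (he e).1]

end Existence

/-! ### Equivalence of any two deformation quantizations. -/

section Uniqueness

variable {S : StarProduct A} (b b' : DeformationQuantization S Γ)

/-- The defect of `∑ r, λ ^ r T r` to be a module homomorphism. -/
def homDefect (T : ℕ → Γ →ₗ[ℂ] Γ) (φ : FormalSeries Γ) (f : FormalSeries A) : FormalSeries Γ :=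
  formalLin T (b.act φ f) - b'.act (formalLin T φ) f

variable (T : ℕ → Γ →ₗ[ℂ] Γ)

theorem isFormal_homDefect₁ (f : FormalSeries A) : IsFormal (fun φ => homDefect b b' T φ f) :=
  ((isFormal_formalLin T).comp (isFormal_formalBilin_left b.R f)).sub
    ((isFormal_formalBilin_left b'.R f).comp (isFormal_formalLin T))

theorem isFormal_homDefect₂ (φ : FormalSeries Γ) : IsFormal (fun f => homDefect b b' T φ f) :=
  ((isFormal_formalLin T).comp (isFormal_formalBilin_right b.R φ)).sub
    (isFormal_formalBilin_right b'.R _)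

/-- Valid for arbitrary `T`, by the module law of both actions; its lowest-degree part is the
Hochschild 1-cocycle equation. -/
theorem homDefect_cocycle (φ : FormalSeries Γ) (f g : FormalSeries A) :
    homDefect b b' T (b.act φ f) g - homDefect b b' T φ (S.mul f g) +
      b'.act (homDefect b b' T φ f) g = 0 := by
  have h := (isFormal_formalBilin_left b'.R g).map_sub (formalLin T (b.act φ f))
    (b'.act (formalLin T φ) f)
  have hb := b.act_mul φ f g
  have hb' := b'.act_mul (formalLin T φ) f g
  simp only [homDefect, DeformationQuantization.act] at h hb hb' ⊢
  rw [h, hb, hb']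
  abel

variable {T} in
theorem homDefect_congr {T' : ℕ → Γ →ₗ[ℂ] Γ} {n : ℕ} (h : ∀ k ≤ n, T k = T' k)
    (φ : FormalSeries Γ) (f : FormalSeries A) :
    homDefect b b' T φ f n = homDefect b b' T' φ f n := by
  simp only [homDefect, Pi.sub_apply, DeformationQuantization.act]
  rw [formalLin_congr h (fun _ _ => rfl) le_rfl,
    formalBilin_congr (fun _ _ => rfl)
      (fun k hk => formalLin_congr h (fun _ _ => rfl) hk) (fun _ _ => rfl) le_rfl]

theorem homDefect_fconst (n : ℕ) (φ : Γ) (f : A) :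
    homDefect b b' T (fconst φ) (fconst f) n =
      (∑ p ∈ Finset.HasAntidiagonal.antidiagonal n, T p.1 (b.R p.2 φ f)) -
        ∑ p ∈ Finset.HasAntidiagonal.antidiagonal n, b'.R p.1 (T p.2 φ) f := by
  simp only [homDefect, Pi.sub_apply, DeformationQuantization.act, formalBilin_fconst_right,
    formalLin_fconst]
  simp only [formalLin, formalBilin_fconst]

variable {T}

theorem isDiffFamily_const {D : Γ →ₗ[ℂ] Γ} (h : IsDiffOp A D) :
    IsDiffFamily A (fun (_ : Unit) φ => D φ) :=
  h.imp fun _ h _ => h.isDiffFun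

theorem homDefect_diff₁ {n : ℕ} (hT : ∀ k ≤ n, IsDiffOp A (T k)) :
    IsDiffFamily A (fun (f : A) (φ : Γ) => homDefect b b' T (fconst φ) (fconst f) n) := by
  simp only [homDefect_fconst]
  refine (IsDiffFamily.sum _ fun p hp => ?_).sub (IsDiffFamily.sum _ fun p hp => ?_) <;>
    rw [Finset.HasAntidiagonal.mem_antidiagonal] at hp
  · exact (isDiffFamily_const (hT p.1 (by omega))).comp (isBidiffOp_iff.1 (b.isBidiffOp p.2)).1
      fun _ => ()
  · exact (isBidiffOp_iff.1 (b'.isBidiffOp p.1)).1.comp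
      ((isDiffFamily_const (hT p.2 (by omega))).reparam fun _ : A => ()) fun f => f

theorem homDefect_diff₂ {n : ℕ} (hT : ∀ k ≤ n, IsDiffOp A (T k)) :
    IsDiffFamily A (fun (φ : Γ) (f : A) => homDefect b b' T (fconst φ) (fconst f) n) := by
  simp only [homDefect_fconst]
  refine (IsDiffFamily.sum _ fun p hp => ?_).sub (IsDiffFamily.sum _ fun p hp => ?_) <;>
    rw [Finset.HasAntidiagonal.mem_antidiagonal] at hp
  · exact (isDiffFamily_const (hT p.1 (by omega))).comp (isBidiffOp_iff.1 (b.isBidiffOp p.2)).2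
      fun _ => ()
  · exact (isBidiffOp_iff.1 (b'.isBidiffOp p.1)).2.reparam (T p.2)

/-- Hochschild `1`-cocycles with values in differential operators on `Γ` are coboundaries. -/
theorem exists_diff_primitive (fr : LocallyFiniteFrame A Γ ι) {c : Γ → A → Γ}
    (h₁ : IsDiffFamily A (fun f φ => c φ f)) (h₂ : IsDiffFamily A c)
    (hc : ∀ φ f g, c (f • φ) g - c φ (f * g) + g • c φ f = 0) :
    ∃ x : Γ →ₗ[ℂ] Γ, IsDiffOp A x ∧ ∀ φ f, x (f • φ) - f • x φ + c φ f = 0 := by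
  have hmem : ∀ φ, (fun i => c (fr.s i) (fr.ξ i φ)) ∈ fr.summable := fun φ =>
    fr.mem (fun i a => c (fr.s i) a) (fun i => h₂.isDiffFun (fr.s i)) φ
  obtain ⟨k, hk⟩ := h₂
  have hd : IsDiffFun A k (fun φ => fr.sum ⟨_, hmem φ⟩) :=
    IsDiffFun.linear_sum fr.sum (D := fun i φ => c (fr.s i) (fr.ξ i φ))
      (fun i => (hk (fr.s i)).comp (IsDiffFun.linear (fr.ξ i))) hmem
  -- The sign is forced: applying `hc` to `s i, ξ i φ, f` and summing gives `c(φ, f)` as the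
  -- coboundary of `∑ c(s i, ξ i φ)`.
  obtain ⟨x, hx, hx'⟩ := hd.neg
  refine ⟨x, ⟨k, hx⟩, fun φ f => ?_⟩
  have hcf := h₁.isDiffFun f
  simp only [hx']
  rw [← fr.sum_eq (fun φ => c φ f) hcf φ (fr.mem_smul hcf φ), ← map_neg, ← map_neg,
    ← map_smul, ← map_sub, ← map_add, ← map_zero fr.sum]
  congr 1
  ext i
  have hξ : fr.ξ i (f • φ) = fr.ξ i φ * f := by rw [map_smul, smul_eq_mul, mul_comm]
  simp only [Submodule.coe_add, Submodule.coe_sub, Submodule.coe_smul, Submodule.coe_neg,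
    Submodule.coe_zero, Pi.add_apply, Pi.sub_apply, Pi.neg_apply, Pi.zero_apply,
    Pi.smul_apply, smul_neg, hξ]
  rw [← hc (fr.s i) (fr.ξ i φ) f]
  abel

/-- The identity can be extended to a module homomorphism from order `n - 1` to order `n`. -/
theorem exists_next_hom_coeff (fr : LocallyFiniteFrame A Γ ι) {n : ℕ}
    (hT : ∀ k < n, IsDiffOp A (T k))
    (hdef : ∀ k < n, ∀ φ f, homDefect b b' T (fconst φ) (fconst f) k = 0) :
    ∃ x : Γ →ₗ[ℂ] Γ, IsDiffOp A x ∧ ∀ φ f,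
      homDefect b b' (Function.update T n x) (fconst φ) (fconst f) n = 0 := by
  set Q := Function.update T n 0 with hQdef
  have hR₀ : b.R 0 = rsmul A Γ := LinearMap.ext₂ b.R_zero
  have hR'₀ : b'.R 0 = rsmul A Γ := LinearMap.ext₂ b'.R_zero
  have hQ : ∀ k ≤ n, IsDiffOp A (Q k) := fun k hk => by
    rcases hk.lt_or_eq with h | rfl
    · rw [hQdef, Function.update_of_ne h.ne]
      exact hT k h
    · rw [hQdef, Function.update_self]
      exact ⟨0, .zero 0⟩
  obtain ⟨hlt, heq⟩ := formal_two_lowest (isFormal_homDefect₁ b b' Q)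
    (isFormal_homDefect₂ b b' Q) (n := n) (fun φ f k hk => by
      rw [← hdef k hk φ f]
      refine homDefect_congr b b' (fun l hl => ?_) _ _
      rw [hQdef, Function.update_of_ne (by omega)])
  obtain ⟨x, hx, hcx⟩ := exists_diff_primitive fr (homDefect_diff₁ b b' hQ)
    (homDefect_diff₂ b b' hQ) (by
      intro φ f g
      have := congrFun (homDefect_cocycle b b' Q (fconst φ) (fconst f) (fconst g)) n
      have low := formalBilin_eq_of_lowest (B := b'.R) (n := n)
        (v := homDefect b b' Q (fconst φ) (fconst f)) (v' := 0)
        (fun k hk => hlt _ _ k hk) (fconst g)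
      rw [(isFormal_formalBilin_left b'.R (fconst g)).map_zero] at low
      simp only [Pi.add_apply, Pi.sub_apply, Pi.zero_apply, DeformationQuantization.act] at this
      rw [low, heq (formalBilin _ _ _), heq _ (S.mul _ _)] at this
      simpa [StarProduct.mul, formalBilin_apply_zero, hR₀, hR'₀, S.C_zero] using this)
  refine ⟨x, hx, fun φ f => ?_⟩
  have key := hcx φ f
  set T' := Function.update T n x with hT'def
  -- In degree `n` the unknown contributes `x(f φ)` through `T (φ • f)` and `f x(φ)` through `T φ •'
  -- f`.
  have low := formalBilin_eq_of_lowest (B := b'.R) (n := n)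
    (v := formalLin T' (fconst φ)) (v' := formalLin Q (fconst φ))
    (fun k hk => formalLin_update_of_lt T hk _ _ _) (fconst f)
  simp only [homDefect, Pi.sub_apply, DeformationQuantization.act] at key ⊢
  rw [low, formalLin_update T n x (fconst φ), formalLin_update T n x, ← hQdef,
    formalBilin_apply_zero, hR₀, hR'₀]
  simp only [fconst_apply_zero, rsmul_apply, add_sub_cancel_left]
  rw [← key]
  abel

theorem DeformationQuantization.equivalent (fr : LocallyFiniteFrame A Γ ι) : b.Equivalent b' := by
  obtain ⟨T, hT⟩ := exists_seq_of_step (X := Γ →ₗ[ℂ] Γ)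
    (fun n T => T 0 = LinearMap.id ∧ IsDiffOp A (T n) ∧
      ∀ φ f, homDefect b b' T (fconst φ) (fconst f) n = 0)
    (fun n T T' h hT => ⟨by rw [← h 0 n.zero_le, hT.1], by rw [← h n le_rfl]; exact hT.2.1,
      fun φ f => by rw [← homDefect_congr b b' h, hT.2.2]⟩)
    (fun n T hT => by
      rcases Nat.eq_zero_or_pos n with rfl | hn
      · refine ⟨LinearMap.id, by simp, ?_, fun φ f => ?_⟩
        · rw [Function.update_self]
          exact ⟨0, IsDiffFun.isDiffOpOfOrder (D := LinearMap.id) IsDiffFun.id⟩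
        · simp [homDefect, DeformationQuantization.act, formalBilin_apply_zero,
            formalLin_apply_zero, b.R_zero, b'.R_zero]
      · obtain ⟨x, hx, h⟩ := exists_next_hom_coeff b b' fr
          (fun k hk => (hT k hk).2.1) (fun k hk => (hT k hk).2.2)
        refine ⟨x, ?_, by simpa using hx, h⟩
        rw [Function.update_of_ne hn.ne, (hT 0 hn).1])
  refine ⟨T, (hT 0).1, fun n => (hT n).2.1, fun φ f => ?_⟩
  rw [← sub_eq_zero]
  funext n
  exact (formal_two_lowest (isFormal_homDefect₁ b b' T) (isFormal_homDefect₂ b b' T)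
    (n := n + 1) (fun φ f k _ => (hT k).2.2 φ f)).1 φ f n n.lt_succ_self

end Uniqueness

/-! ### Locally finite frames for sections of a vector bundle. -/

section Manifold

open Bundle Topology

variable {d : ℕ} {M : Type*} [TopologicalSpace M] [ChartedSpace (EuclideanSpace ℝ (Fin d)) M]
  {F : Type*} [NormedAddCommGroup F] [NormedSpace ℂ F]
  {E : M → Type*} [TopologicalSpace (TotalSpace F E)]
  [∀ x, TopologicalSpace (E x)] [∀ x, AddCommGroup (E x)] [∀ x, Module ℂ (E x)]
  [FiberBundle F E] [VectorBundle ℂ F E]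

/-- Evaluation of sections at a point. -/
noncomputable def SmoothSec.eval (x : M) : SmoothSec d F E →+ E x where
  toFun s := s x
  map_zero' := rfl
  map_add' _ _ := rfl

theorem SmoothSec.sum_apply {ι : Type*} (J : Finset ι) (s : ι → SmoothSec d F E) (x : M) :
    (∑ i ∈ J, s i) x = ∑ i ∈ J, s i x :=
  map_sum (SmoothSec.eval x) s J

/-- Differential operators are local. -/
theorem IsDiffOpOfOrder.apply_eq_zero {V : Type*} [AddCommGroup V] [Module ℂ V]
    [Module (SmoothFun d M) V] [IsScalarTower ℂ (SmoothFun d M) V] {g : SmoothFun d M} {x : M}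
    (hg : g x = 0) {v : V} (hv : g • v = v) {k : ℕ} {D : V →ₗ[ℂ] SmoothSec d F E}
    (hD : IsDiffOpOfOrder (SmoothFun d M) k D) : D v x = 0 := by
  -- As `g v = v` and `g x = 0`, the sections `D v` and `[D, g] v` agree at `x`, and the commutator
  -- has lower order.
  have key : ∀ D : V →ₗ[ℂ] SmoothSec d F E, comm D g v x = 0 → D v x = 0 := by
    intro D h
    rw [comm_apply, hv] at h
    change D v x - g x • D v x = 0 at h
    simpa [hg] using h
  induction k generalizing D with
  | zero =>
    refine key D ?_
    rw [hD g]
    rfl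
  | succ k ih => exact key D (ih (hD g))

section Cutoff

variable [T2Space M] [SecondCountableTopology M] [IsManifold (𝓡 d) ∞ M]

/-- Multiplication by such a `g` fixes everything that vanishes on `U`, as the locality argument
requires. -/
theorem exists_smoothFun_eq_zero_eq_one {x : M} {U : Set M} (hU : U ∈ 𝓝 x) :
    ∃ g : SmoothFun d M, g x = 0 ∧ ∀ y ∉ U, g y = 1 := by
  have : LocallyCompactSpace M := ChartedSpace.locallyCompactSpace (EuclideanSpace ℝ (Fin d)) M
  obtain ⟨g, h0, h1, -⟩ := exists_contMDiffMap_zero_one_of_isClosed (𝓡 d) (n := ⊤)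
    (isClosed_singleton (x := x)) (isOpen_interior (s := U)).isClosed_compl
    (Set.disjoint_singleton_left.2 (by simpa using mem_interior_iff_mem_nhds.2 hU))
  refine ⟨⟨fun y => (g y : ℂ), Complex.ofRealCLM.contDiff.contMDiff.comp g.contMDiff⟩, ?_,
    fun y hy => ?_⟩
  · exact Complex.ofReal_eq_zero.2 (h0 rfl)
  · exact Complex.ofReal_eq_one.2 (h1 fun h => hy (interior_subset h))

theorem IsDiffFun.apply_eq_zero_of_fun {k : ℕ} {D : SmoothFun d M → SmoothSec d F E}
    (hD : IsDiffFun (SmoothFun d M) k D) {f : SmoothFun d M} {x : M}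
    (hf : ∀ᶠ y in 𝓝 x, f y = 0) : D f x = 0 := by
  obtain ⟨g, h0, h1⟩ := exists_smoothFun_eq_zero_eq_one (d := d) hf
  obtain ⟨D', hD', h⟩ := hD
  rw [← h]
  refine hD'.apply_eq_zero h0 (ContMDiffMap.ext fun y => ?_)
  change g y * f y = f y
  by_cases hy : f y = 0
  · simp [hy]
  · rw [h1 y hy, one_mul]

theorem IsDiffFun.apply_eq_zero_of_sec {k : ℕ} {D : SmoothSec d F E → SmoothSec d F E}
    (hD : IsDiffFun (SmoothFun d M) k D) {s : SmoothSec d F E} {x : M}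
    (hs : ∀ᶠ y in 𝓝 x, s y = 0) : D s x = 0 := by
  obtain ⟨g, h0, h1⟩ := exists_smoothFun_eq_zero_eq_one (d := d) hs
  obtain ⟨D', hD', h⟩ := hD
  rw [← h]
  refine hD'.apply_eq_zero h0 (ContMDiffSection.ext fun y => ?_)
  change g y • s y = s y
  by_cases hy : s y = 0
  · simp [hy]
  · rw [h1 y hy, one_smul]

end Cutoff

section Summation

variable {ι : Type*} {K : ι → Set M}

variable (d F E K) in
/-- Families of sections with supports in given sets. -/
def supportedFamilies : Submodule (SmoothFun d M) (ι → SmoothSec d F E) where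
  carrier := {γ | ∀ i, ∀ x ∉ K i, γ i x = 0}
  zero_mem' _ _ _ := rfl
  add_mem' {γ δ} hγ hδ i x hx := by
    change γ i x + δ i x = 0
    rw [hγ i x hx, hδ i x hx, add_zero]
  smul_mem' f γ hγ i x hx := by
    change f x • γ i x = 0
    rw [hγ i x hx, smul_zero]

theorem LocallyFinite.finite_support (hK : LocallyFinite K) {γ : ι → SmoothSec d F E}
    (hγ : γ ∈ supportedFamilies d F E K) (x : M) : (Function.support fun i => γ i x).Finite :=
  (hK.point_finite x).subset fun i hi => by
    by_contra h
    exact hi (hγ i x h)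

/-- The sum of a locally finite family of sections. -/
noncomputable def locallyFiniteSum (hK : LocallyFinite K) :
    supportedFamilies d F E K →ₗ[SmoothFun d M] SmoothSec d F E where
  toFun γ := ⟨fun x => ∑ᶠ i, γ.1 i x, ContMDiff.finsum_section_of_locallyFinite
    (hK.subset fun i x hx => by
      by_contra h
      exact hx (γ.2 i x h)) fun i => (γ.1 i).contMDiff⟩
  map_add' γ δ := ContMDiffSection.ext fun x =>
    finsum_add_distrib (LocallyFinite.finite_support hK γ.2 x)
      (LocallyFinite.finite_support hK δ.2 x)
  map_smul' f γ := ContMDiffSection.ext fun x =>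
    (smul_finsum' (f x) (LocallyFinite.finite_support hK γ.2 x)).symm

theorem locallyFiniteSum_apply (hK : LocallyFinite K) (γ : supportedFamilies d F E K) (x : M) :
    locallyFiniteSum hK γ x = ∑ᶠ i, γ.1 i x := rfl

variable [T2Space M] [SecondCountableTopology M] [IsManifold (𝓡 d) ∞ M]

/-- A locally finite frame from sections and linear forms with locally finite supports. -/
noncomputable def locallyFiniteFrameOfSupports (hK : LocallyFinite K) (hc : ∀ i, IsClosed (K i))
    (s : ι → SmoothSec d F E) (ξ : ι → SmoothSec d F E →ₗ[SmoothFun d M] SmoothFun d M)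
    (hξ : ∀ i φ, ∀ x ∉ K i, ξ i φ x = 0)
    (hs : ∀ (φ : SmoothSec d F E) (x : M), ∑ᶠ i, ξ i φ x • s i x = φ x) :
    LocallyFiniteFrame (SmoothFun d M) (SmoothSec d F E) ι where
  s := s
  ξ := ξ
  summable := supportedFamilies d F E K
  sum := locallyFiniteSum hK
  mem D hD φ i x hx := by
    obtain ⟨k, hD⟩ := hD i
    refine hD.apply_eq_zero_of_fun ?_
    filter_upwards [(hc i).isOpen_compl.mem_nhds hx] with y hy using hξ i φ y hy
  sum_eq := by
    rintro D ⟨k, hD⟩ φ h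
    refine ContMDiffSection.ext fun x => ?_
    rw [locallyFiniteSum_apply]
    obtain ⟨U, hU, hfin⟩ := hK x
    have hJ : ∀ y ∈ U, ∀ i, y ∈ K i → i ∈ hfin.toFinset := fun y hy i hi =>
      hfin.mem_toFinset.2 ⟨y, hi, hy⟩
    -- Near `x` only finitely many supports matter, so `φ` coincides there with a finite sum;
    -- locality lets `D` pass through it.
    have hnear : D (φ - ∑ i ∈ hfin.toFinset, ξ i φ • s i) x = 0 := by
      refine hD.apply_eq_zero_of_sec ?_
      filter_upwards [hU] with y hy
      change φ y - (∑ i ∈ hfin.toFinset, ξ i φ • s i : SmoothSec d F E) y = 0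
      rw [SmoothSec.sum_apply, ← hs φ y, finsum_eq_sum_of_support_subset, sub_eq_zero]
      · rfl
      · intro i hi
        by_contra hn
        refine hi ?_
        have : ξ i φ y = 0 := hξ i φ y fun hyK => hn (hJ y hy i hyK)
        simp [this]
    obtain ⟨D', hD', hDD⟩ := hD
    simp only [← hDD] at h hnear ⊢
    rw [map_sub, map_sum] at hnear
    change D' φ x - (∑ i ∈ hfin.toFinset, D' (ξ i φ • s i) : SmoothSec d F E) x = 0 at hnear
    rw [sub_eq_zero, SmoothSec.sum_apply] at hnear
    rw [hnear]
    refine finsum_eq_sum_of_support_subset _ fun i hi => ?_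
    by_contra hn
    exact hi (h i x fun hxK => hn (hJ x (mem_of_mem_nhds hU) i hxK))

end Summation

section Frame

variable [ContMDiffVectorBundle ∞ F E (𝓡 d)]

/-- Cutting off a linear form in a local trivialization gives a linear form on smooth sections. -/
noncomputable def cutoffForm (ρ : C^∞⟮𝓡 d, M; 𝓘(ℝ), ℝ⟯)
    (e : Trivialization F (TotalSpace.proj : TotalSpace F E → M)) [MemTrivializationAtlas e]
    (hρ : tsupport ρ ⊆ e.baseSet) (l : F →L[ℂ] ℂ) :
    SmoothSec d F E →ₗ[SmoothFun d M] SmoothFun d M where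
  toFun φ := ⟨fun x => ρ x • l (e ⟨x, φ x⟩).2, contMDiff_of_tsupport fun x hx => by
    have hx' : x ∈ e.baseSet := hρ (tsupport_smul_subset_left ρ _ hx)
    refine ρ.contMDiff.contMDiffAt.smul ?_
    exact (l.restrictScalars ℝ).contDiff.contMDiff.contMDiffAt.comp x
      ((e.contMDiffAt_section_iff hx').1 (φ.contMDiff x))⟩
  map_add' φ ψ := ContMDiffMap.ext fun x => by
    change ρ x • l (e ⟨x, φ x + ψ x⟩).2 = ρ x • l (e ⟨x, φ x⟩).2 + ρ x • l (e ⟨x, ψ x⟩).2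
    by_cases hx : x ∈ e.baseSet
    · rw [(e.linear ℂ hx).map_add, map_add, smul_add]
    -- Off the base set the trivialization need not be linear, but `ρ` vanishes there.
    · simp [image_eq_zero_of_notMem_tsupport fun h => hx (hρ h)]
  map_smul' f φ := ContMDiffMap.ext fun x => by
    change ρ x • l (e ⟨x, f x • φ x⟩).2 = f x * ρ x • l (e ⟨x, φ x⟩).2
    by_cases hx : x ∈ e.baseSet
    · rw [(e.linear ℂ hx).map_smul, map_smul, smul_eq_mul, mul_smul_comm]
    · simp [image_eq_zero_of_notMem_tsupport fun h => hx (hρ h)]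

theorem cutoffForm_apply (ρ : C^∞⟮𝓡 d, M; 𝓘(ℝ), ℝ⟯)
    (e : Trivialization F (TotalSpace.proj : TotalSpace F E → M)) [MemTrivializationAtlas e]
    (hρ : tsupport ρ ⊆ e.baseSet) (l : F →L[ℂ] ℂ) (φ : SmoothSec d F E) (x : M) :
    cutoffForm ρ e hρ l φ x = ρ x • l (e ⟨x, φ x⟩).2 := rfl

/-- Cutting off a constant section of a local trivialization. -/
noncomputable def cutoffSection (χ : C^∞⟮𝓡 d, M; 𝓘(ℝ), ℝ⟯)
    (e : Trivialization F (TotalSpace.proj : TotalSpace F E → M)) [MemTrivializationAtlas e]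
    (hχ : ∀ᶠ x in 𝓝ˢ e.baseSetᶜ, χ x = 0) (v : F) : SmoothSec d F E :=
  ⟨fun x => χ x • e.symm x v, fun x => by
    by_cases hx : x ∈ e.baseSet
    · refine ContMDiffAt.smul_section χ.contMDiff.contMDiffAt ?_
      refine (e.contMDiffAt_section_iff hx).2 ((contMDiffAt_const (c := v)).congr_of_eventuallyEq ?_)
      filter_upwards [e.open_baseSet.mem_nhds hx] with y hy
      rw [e.apply_mk_symm hy]
    -- Smoothness off the base set needs `χ` to vanish on a whole neighbourhood of the point, hence
    -- the neighbourhood filter in `hχ`.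
    · refine (Bundle.contMDiff_zeroSection ℝ E x).congr_of_eventuallyEq ?_
      filter_upwards [hχ.filter_mono (nhds_le_nhdsSet hx)] with y hy
      simp [hy, zeroSection]⟩

theorem cutoffSection_apply (χ : C^∞⟮𝓡 d, M; 𝓘(ℝ), ℝ⟯)
    (e : Trivialization F (TotalSpace.proj : TotalSpace F E → M)) [MemTrivializationAtlas e]
    (hχ : ∀ᶠ x in 𝓝ˢ e.baseSetᶜ, χ x = 0) (v : F) (x : M) :
    cutoffSection χ e hχ v x = χ x • e.symm x v := rfl

variable (d M F E) in
-- In each trivialization the basis sections are cut off by `χ p` and the dual basis by `ρ p`. Since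
-- `χ p = 1` on the support of `ρ p`, chart `p` contributes `ρ p • φ`, and these add up to `φ`.
theorem exists_locallyFiniteFrame [T2Space M] [SecondCountableTopology M] [IsManifold (𝓡 d) ∞ M]
    [FiniteDimensional ℂ F] :
    Nonempty (LocallyFiniteFrame (SmoothFun d M) (SmoothSec d F E)
      (M × Fin (Module.finrank ℂ F))) := by
  have : LocallyCompactSpace M := ChartedSpace.locallyCompactSpace (EuclideanSpace ℝ (Fin d)) M
  let b := Module.finBasis ℂ F
  let e : ∀ p : M, Trivialization F (TotalSpace.proj : TotalSpace F E → M) := trivializationAt F E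
  obtain ⟨ρ, hρ⟩ := SmoothPartitionOfUnity.exists_isSubordinate (𝓡 d) isClosed_univ
    (fun p => (e p).baseSet) (fun p => (e p).open_baseSet)
    (fun p _ => Set.mem_iUnion.2 ⟨p, FiberBundle.mem_baseSet_trivializationAt' p⟩)
  have hχ : ∀ p, ∃ χ : C^∞⟮𝓡 d, M; 𝓘(ℝ), ℝ⟯, (∀ᶠ x in 𝓝ˢ (e p).baseSetᶜ, χ x = 0) ∧
      ∀ x ∈ tsupport (ρ p), χ x = 1 := fun p => by
    obtain ⟨χ, h0, h1, -⟩ := exists_contMDiffMap_zero_one_nhds_of_isClosed (𝓡 d) (n := ⊤)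
      (e p).open_baseSet.isClosed_compl (isClosed_tsupport (ρ p))
      (Set.disjoint_left.2 fun x hx hx' => hx (hρ p hx'))
    exact ⟨χ, h0, fun x hx => h1.self_of_nhdsSet x hx⟩
  choose χ hχ0 hχ1 using hχ
  have hfin : LocallyFinite fun p => tsupport (ρ p) := ρ.locallyFinite.closure
  have hK : LocallyFinite fun i : M × Fin (Module.finrank ℂ F) => tsupport (ρ i.1) := by
    intro x
    obtain ⟨U, hU, hf⟩ := hfin x
    refine ⟨U, hU, (hf.prod Set.finite_univ).subset fun i hi => ⟨hi, Set.mem_univ _⟩⟩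
  refine ⟨locallyFiniteFrameOfSupports hK (fun i => isClosed_tsupport _)
    (fun i => cutoffSection (χ i.1) (e i.1) (hχ0 i.1) (b i.2))
    (fun i => cutoffForm (ρ i.1) (e i.1) (hρ i.1) (b.coord i.2).toContinuousLinearMap)
    (fun i φ x hx => ?_) (fun φ x => ?_)⟩
  · rw [cutoffForm_apply, image_eq_zero_of_notMem_tsupport hx, zero_smul]
  · have hx := hfin.point_finite x
    have hterm : ∀ p, ∑ a, cutoffForm (ρ p) (e p) (hρ p) (b.coord a).toContinuousLinearMap φ x •
        cutoffSection (χ p) (e p) (hχ0 p) (b a) x = ρ p x • φ x := by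
      intro p
      by_cases hp : x ∈ tsupport (ρ p)
      · have hxe : x ∈ (e p).baseSet := hρ p hp
        simp only [cutoffForm_apply, cutoffSection_apply, hχ1 p x hp, one_smul, smul_assoc,
          ← Finset.smul_sum]
        congr 1
        -- Expand the coordinates of `φ x` in the basis of `F` and carry the expansion back to the
        -- fibre.
        have h := congrArg ((e p).symmₗ ℂ x) (b.sum_repr ((e p) ⟨x, φ x⟩).2)
        simp only [map_sum, map_smul] at h
        simp only [(e p).symmₗ_apply hxe] at h
        exact h.trans ((e p).symm_apply_apply_mk hxe (φ x))
      · simp [cutoffForm_apply, image_eq_zero_of_notMem_tsupport hp]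
    rw [finsum_eq_sum_of_support_subset (s := hx.toFinset ×ˢ Finset.univ), Finset.sum_product]
    · simp only [hterm]
      rw [← Finset.sum_smul, ← finsum_eq_sum_of_support_subset, ρ.sum_eq_one (Set.mem_univ x),
        one_smul]
      intro p hp
      exact hx.mem_toFinset.2 (subset_tsupport (ρ p) hp)
    · rintro ⟨p, a⟩ hi
      simp only [Finset.coe_product, Set.Finite.coe_toFinset, Finset.coe_univ, Set.mem_prod,
        Set.mem_univ, and_true]
      by_contra hn
      refine hi ?_
      simp only [cutoffForm_apply]
      rw [image_eq_zero_of_notMem_tsupport hn, zero_smul, zero_smul]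

end Frame

end Manifold

end DefQuant

theorem mainTheorem4 (d : ℕ) (M : Type*) [TopologicalSpace M]
    [T2Space M] [SecondCountableTopology M]
    [ChartedSpace (EuclideanSpace ℝ (Fin d)) M] [IsManifold (𝓡 d) ∞ M]
    (F : Type*) [NormedAddCommGroup F] [NormedSpace ℂ F] [FiniteDimensional ℂ F]
    (E : M → Type*) [TopologicalSpace (Bundle.TotalSpace F E)]
    [∀ x, TopologicalSpace (E x)] [∀ x, AddCommGroup (E x)] [∀ x, Module ℂ (E x)]
    [FiberBundle F E] [VectorBundle ℂ F E] [ContMDiffVectorBundle ∞ F E (𝓡 d)]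
    (S : DefQuant.StarProduct (DefQuant.SmoothFun d M)) :
    Nonempty (DefQuant.DeformationQuantization S (DefQuant.SmoothSec d F E)) ∧
      ∀ b b' : DefQuant.DeformationQuantization S (DefQuant.SmoothSec d F E),
        b.Equivalent b' := by
  obtain ⟨fr⟩ := DefQuant.exists_locallyFiniteFrame d M F E
  exact ⟨DefQuant.exists_deformationQuantization fr S, fun b b' => b.equivalent b' fr⟩
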